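/- Let $\Omega=\{x\in\mathbb{R}^3:|x|=1\}$ be the unit sphere with surface measure $d\omega$, let $\Delta^*$ be the Beltrami (Laplace--Beltrami) operator on $\Omega$, and let $$G(\Delta^*;t)=\frac{1}{4\pi}\ln(1-t)+\frac{1}{4\pi}(1-\ln 2),\qquad t\in[-1,1),$$ be its fundamental solution. Let $\Gamma\subset\Omega$ be (relatively) open; in particular, $\Gamma$ may be any domain with a smooth boundary curve. Let $H$ be of class $C^{(1)}(\overline\Gamma)$, i.e., $H$ is continuous on $\overline\Gamma$ and of class $C^{(1)}$ in $\Gamma$, and its surface gradient $\nabla^*H$ extends continuously from $\Gamma$ to $\overline\Gamma$. Then $H$ is integrable over $\Gamma$, the integral $$U(\xi)=\int_\Gamma G(\Delta^*;\xi\cdot\eta)\,H(\eta)\,d\omega(\eta)$$ converges absolutely for every $\xi\in\Omega$, the function $U$ is of class $C^{(2)}$ in $\Gamma$, and $$\Delta^*U(\xi)=H(\xi)-\frac{1}{4\pi}\int_\Gamma H(\eta)\,d\omega(\eta),\qquad \xi\in\Gamma.$$ -/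

import Mathlib

open MeasureTheory Metric
open scoped Manifold ContDiff RealInnerProductSpace

noncomputable section

/-- Three-dimensional Euclidean space. -/
abbrev E3 : Type := EuclideanSpace ℝ (Fin 3)

/-- The unit sphere `Ω` in three-dimensional Euclidean space. -/
abbrev UnitSphere : Type := sphere (0 : E3) 1

instance factFinrankE3 : Fact (Module.finrank ℝ E3 = 2 + 1) := ⟨by simp⟩

/-- The surface measure `dω` on the unit sphere (of total mass `4π`). -/
def surfaceMeasure : Measure UnitSphere := (volume : Measure E3).toSphere

/-- The extension `x ↦ F (x / |x|)` of a function on the sphere that is constant along rays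
(with the irrelevant value `0` at the origin). -/
def radialExtension (F : UnitSphere → ℝ) (x : E3) : ℝ :=
  open Classical in
  if hx : x ≠ 0 then
    F ⟨‖x‖⁻¹ • x, by simp [norm_smul, norm_ne_zero_iff.mpr hx]⟩
  else 0

/-- The surface gradient `∇*`. As `∇ = ξ ∂/∂r + (1/r) ∇*`, it is the Euclidean gradient of the
extension that is constant along rays, taken at a point of the sphere. -/
def surfaceGradient (F : UnitSphere → ℝ) (ξ : UnitSphere) : E3 :=
  gradient (radialExtension F) (ξ : E3)

/-- The Beltrami operator `Δ*`. As `Δ = r⁻² ∂/∂r (r² ∂/∂r) + r⁻² Δ*`, it is the Euclidean Laplacian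
of the extension that is constant along rays, taken at a point of the sphere. -/
def beltrami (F : UnitSphere → ℝ) (ξ : UnitSphere) : ℝ :=
  Laplacian.laplacian (radialExtension F) (ξ : E3)

/-- `F` is of class `C^(k)` in the open subset `Γ` of the sphere. -/
def IsClassC (k : ℕ) (Γ : Set UnitSphere) (F : UnitSphere → ℝ) : Prop :=
  ContMDiffOn (𝓡 2) 𝓘(ℝ, ℝ) k F Γ

/-- `F` is of class `C^(1)` on the closure of the open subset `Γ` of the sphere: it is continuous
on the closure and `C^(1)` in `Γ`, and its first-order derivatives extend continuously to the
closure. Only the values of `F` on the closure of `Γ` matter. -/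
structure IsClassC1Closure (Γ : Set UnitSphere) (F : UnitSphere → ℝ) : Prop where
  continuousOn : ContinuousOn F (closure Γ)
  isClassC : IsClassC 1 Γ F
  gradient_extends : ∃ g : UnitSphere → E3,
    ContinuousOn g (closure Γ) ∧ Set.EqOn g (surfaceGradient F) Γ

/-- The fundamental solution `G(Δ*; t)`, for `-1 ≤ t < 1`, of the Beltrami operator. -/
def fundamentalSolution (t : ℝ) : ℝ :=
  1 / (4 * Real.pi) * Real.log (1 - t) + 1 / (4 * Real.pi) * (1 - Real.log 2)

/-- The surface Newton potential `U(ξ) = ∫_Γ G(Δ*; ξ·η) H(η) dω(η)`. -/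
def surfacePotential (Γ : Set UnitSphere) (H : UnitSphere → ℝ) (ξ : UnitSphere) : ℝ :=
  ∫ η in Γ, fundamentalSolution ⟪(ξ : E3), (η : E3)⟫ * H η ∂surfaceMeasure

end

/-! Let `L_i` be the derivative along the rotation about the `i`-th axis. On functions constant
along rays, the Laplacian at a point of the sphere is the sum of the `L_i ^ 2`. Since rotations
preserve surface measure, every `L_i F` has integral zero. This is the only integration by parts
needed, so neither charts nor boundary terms appear; for zonal kernels it gives
`integral_zonal_green`.

First derivatives: replace `1 - t` by `1 + ε - t` in the kernel. The regularized potentials may be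
differentiated under the integral, and their gradients converge locally uniformly away from the
origin, with rate `ε ^ (1/4)`. So the potential of a bounded measurable density is `C¹` there
(`hasFDerivAt_potential`).

Second derivatives: twice differentiating the kernel produces the non-integrable size `(1 - t)⁻¹`.
Near a point `ξ` of `Γ`, the density is therefore split as `f + g`, with `f` of class `C¹` on the
whole sphere, `f ξ = H ξ`, and `g` zero near `ξ`. For `f`, zonality of the kernel moves one rotation
onto the density (`rotPotential_eq_potential`): `L_i U_f` is the potential of `L_i f`, hence again
`C¹`. The remaining sum is a limit of regularized sums, which Green's identity turns into the
integral of `f` against an approximate identity minus `1 / (4π)` (`sum_rotPotential_fderiv`). For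
`g`, one differentiates directly, and off the pole the kernel satisfies `Δ* G = -1 / (4π)`
(`sum_integral_rotKernelDeriv`). The two contributions add up to `H ξ` minus the mean of the
density. -/

open Filter Topology
open scoped Pointwise

/-! ### Infinitesimal rotations and invariance of surface measure -/

section Rotations

/-- The infinitesimal rotation `y ↦ a × y`. -/
noncomputable def crossCLM (a : E3) : E3 →L[ℝ] E3 :=
  LinearMap.toContinuousLinearMap
    { toFun := fun b => WithLp.toLp 2 (crossProduct (WithLp.ofLp a) (WithLp.ofLp b))
      map_add' := fun x y => by simp
      map_smul' := fun c x => by simp }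

/-- The infinitesimal rotation about the `i`-th coordinate axis. -/
noncomputable def rotGen (i : Fin 3) : E3 →L[ℝ] E3 := crossCLM (EuclideanSpace.single i 1)

lemma rotGen_zero_apply (y : E3) : rotGen 0 y = !₂[0, -y 2, y 1] := by
  ext j; fin_cases j <;> simp [rotGen, crossCLM, cross_apply]

lemma rotGen_one_apply (y : E3) : rotGen 1 y = !₂[y 2, 0, -y 0] := by
  ext j; fin_cases j <;> simp [rotGen, crossCLM, cross_apply]

lemma rotGen_two_apply (y : E3) : rotGen 2 y = !₂[-y 1, y 0, 0] := by
  ext j; fin_cases j <;> simp [rotGen, crossCLM, cross_apply]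

/-- A linear map is skew if it is antisymmetric with respect to the inner product. -/
def IsSkewMap (A : E3 →L[ℝ] E3) : Prop := ∀ x y : E3, ⟪A x, y⟫ = -⟪x, A y⟫

lemma isSkewMap_rotGen (i : Fin 3) : IsSkewMap (rotGen i) := by
  intro x y
  fin_cases i <;>
  simp [rotGen_zero_apply, rotGen_one_apply, rotGen_two_apply, PiLp.inner_apply,
    Fin.sum_univ_three]

lemma IsSkewMap.inner_self {A : E3 →L[ℝ] E3} (hA : IsSkewMap A) (x : E3) : ⟪x, A x⟫ = 0 := by
  have h := hA x x
  rw [real_inner_comm] at h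
  linarith

/-- Lagrange's identity: `⟪e_i × x, v⟫` is the `i`-th coordinate of `x × v`, so the sum is the inner
product of `x × v` and `x × w`. -/
lemma sum_inner_rotGen_mul (x v w : E3) :
    ∑ i, ⟪rotGen i x, v⟫ * ⟪rotGen i x, w⟫ = ‖x‖ ^ 2 * ⟪v, w⟫ - ⟪x, v⟫ * ⟪x, w⟫ := by
  rw [← real_inner_self_eq_norm_sq]
  simp only [Fin.sum_univ_three, rotGen_zero_apply, rotGen_one_apply, rotGen_two_apply,
    PiLp.inner_apply]
  simp
  ring

lemma sum_rotGen_rotGen (y : E3) : ∑ i, rotGen i (rotGen i y) = (-2 : ℝ) • y := by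
  simp only [Fin.sum_univ_three, rotGen_zero_apply, rotGen_one_apply, rotGen_two_apply]
  ext j
  fin_cases j <;> simp <;> ring

lemma exp_zero_smul_apply (A : E3 →L[ℝ] E3) (x : E3) :
    NormedSpace.exp ((0 : ℝ) • A) x = x := by
  have h : (0 : ℝ) • A = 0 := zero_smul ℝ A
  rw [h, NormedSpace.exp_zero]
  rfl

lemma hasDerivAt_exp_smul_apply (A : E3 →L[ℝ] E3) (x : E3) (s : ℝ) :
    HasDerivAt (fun s : ℝ => NormedSpace.exp (s • A) x) (A (NormedSpace.exp (s • A) x)) s :=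
  (ContinuousLinearMap.apply ℝ E3 x).hasFDerivAt.comp_hasDerivAt s
    (hasDerivAt_exp_smul_const' (𝕂 := ℝ) A s)

lemma IsSkewMap.inner_exp {A : E3 →L[ℝ] E3} (hA : IsSkewMap A) (s : ℝ) (x y : E3) :
    ⟪NormedSpace.exp (s • A) x, NormedSpace.exp (s • A) y⟫ = ⟪x, y⟫ := by
  have h : ∀ s : ℝ, HasDerivAt
      (fun s : ℝ => ⟪NormedSpace.exp (s • A) x, NormedSpace.exp (s • A) y⟫) 0 s := by
    intro s
    have := (hasDerivAt_exp_smul_apply A x s).inner ℝ (hasDerivAt_exp_smul_apply A y s)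
    rwa [hA, add_neg_cancel] at this
  have := is_const_of_deriv_eq_zero (fun s => (h s).differentiableAt) (fun s => (h s).deriv) s 0
  simpa only [exp_zero_smul_apply] using this

/-- The rotation `exp (s A)` generated by a skew map `A`. -/
noncomputable def IsSkewMap.rotation {A : E3 →L[ℝ] E3} (hA : IsSkewMap A) (s : ℝ) : E3 ≃ₗᵢ[ℝ] E3 :=
  LinearIsometry.toLinearIsometryEquiv
    { toLinearMap := (NormedSpace.exp (s • A) : E3 →L[ℝ] E3).toLinearMap
      norm_map' := fun x => by
        have := hA.inner_exp s x x
        rw [real_inner_self_eq_norm_sq, real_inner_self_eq_norm_sq] at this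
        exact (sq_eq_sq₀ (norm_nonneg _) (norm_nonneg _)).1 this } rfl

lemma IsSkewMap.rotation_apply {A : E3 →L[ℝ] E3} (hA : IsSkewMap A) (s : ℝ) (x : E3) :
    hA.rotation s x = NormedSpace.exp (s • A) x := rfl

lemma IsSkewMap.hasDerivAt_rotation {A : E3 →L[ℝ] E3} (hA : IsSkewMap A) (x : E3) (s : ℝ) :
    HasDerivAt (fun s => hA.rotation s x) (A (hA.rotation s x)) s :=
  hasDerivAt_exp_smul_apply A x s

lemma IsSkewMap.rotation_zero {A : E3 →L[ℝ] E3} (hA : IsSkewMap A) (x : E3) :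
    hA.rotation 0 x = x := by
  rw [hA.rotation_apply, exp_zero_smul_apply]

/-- The homeomorphism of the unit sphere induced by a linear isometry. -/
noncomputable def sphereHomeomorph (R : E3 ≃ₗᵢ[ℝ] E3) : UnitSphere ≃ₜ UnitSphere where
  toFun η := ⟨R η, by simp⟩
  invFun η := ⟨R.symm η, by simp⟩
  left_inv η := by ext1; simp
  right_inv η := by ext1; simp
  continuous_toFun := by fun_prop
  continuous_invFun := by fun_prop

@[simp] lemma coe_sphereHomeomorph (R : E3 ≃ₗᵢ[ℝ] E3) (η : UnitSphere) :
    (sphereHomeomorph R η : E3) = R η := rfl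

instance : IsFiniteMeasure surfaceMeasure := by
  unfold surfaceMeasure; infer_instance

/-- Up to the factor 3, the area of a set is the volume of the cone over it; the cone over a
preimage is the preimage of the cone, and `R` preserves volume. -/
lemma measurePreserving_sphereHomeomorph (R : E3 ≃ₗᵢ[ℝ] E3) :
    MeasurePreserving (sphereHomeomorph R) surfaceMeasure surfaceMeasure := by
  refine ⟨(sphereHomeomorph R).continuous.measurable, ?_⟩
  ext s hs
  rw [Measure.map_apply (sphereHomeomorph R).continuous.measurable hs, surfaceMeasure,
    Measure.toSphere_apply' _ ((sphereHomeomorph R).continuous.measurable hs),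
    Measure.toSphere_apply' _ hs]
  congr 1
  have : (Set.Ioo (0 : ℝ) 1 • ((↑) '' (sphereHomeomorph R ⁻¹' s) : Set E3)) =
      R ⁻¹' (Set.Ioo (0 : ℝ) 1 • ((↑) '' s : Set E3)) := by
    ext x
    simp only [Set.mem_smul, Set.mem_image, Set.mem_preimage]
    constructor
    · rintro ⟨r, hr, _, ⟨η, hη, rfl⟩, rfl⟩
      exact ⟨r, hr, _, ⟨_, hη, rfl⟩, by simp⟩
    · rintro ⟨r, hr, _, ⟨η, hη, rfl⟩, h⟩
      refine ⟨r, hr, _, ⟨(sphereHomeomorph R).symm η, by simpa using hη, rfl⟩, ?_⟩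
      apply R.injective
      rw [← h, map_smul, ← coe_sphereHomeomorph, Homeomorph.apply_symm_apply]
  rw [this]
  exact R.measurePreserving.measure_preimage_equiv (f := R.toHomeomorph.toMeasurableEquiv) _

lemma integral_comp_sphereHomeomorph {F : Type*} [NormedAddCommGroup F] [NormedSpace ℝ F]
    (R : E3 ≃ₗᵢ[ℝ] E3) (f : UnitSphere → F) :
    ∫ η, f (sphereHomeomorph R η) ∂surfaceMeasure = ∫ η, f η ∂surfaceMeasure :=
  (measurePreserving_sphereHomeomorph R).integral_comp
    (sphereHomeomorph R).measurableEmbedding f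

lemma surfaceMeasure_univ : surfaceMeasure.real Set.univ = 4 * Real.pi := by
  rw [surfaceMeasure, Measure.toSphere_real_apply_univ, Measure.real,
    EuclideanSpace.volume_ball_fin_three]
  simp only [one_pow, ENNReal.ofReal_one, one_mul, finrank_euclideanSpace, Fintype.card_fin]
  rw [ENNReal.toReal_ofReal (by positivity)]
  push_cast
  ring

end Rotations

/-! ### Integration by parts along rotations -/

section IntegrationByParts

lemma norm_coe_unitSphere (η : UnitSphere) : ‖(η : E3)‖ = 1 := by simp

/-- A function of class `C¹` near the sphere has a bounded derivative on the sphere. -/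
lemma exists_bound_fderiv {F : E3 → ℝ} (hF : ∀ η : UnitSphere, ContDiffAt ℝ 1 F η) :
    Continuous (fun η : UnitSphere => fderiv ℝ F η) ∧
      ∃ C, ∀ η : UnitSphere, ‖fderiv ℝ F η‖ ≤ C := by
  have hc : Continuous (fun η : UnitSphere => fderiv ℝ F η) := by
    rw [continuous_iff_continuousAt]
    intro η
    exact ContinuousAt.comp (f := fun η : UnitSphere => (η : E3))
      ((hF η).fderiv_right (m := 0) (by norm_num)).continuousAt
      continuous_subtype_val.continuousAt
  obtain ⟨C, hC⟩ := isCompact_univ.exists_bound_of_continuousOn hc.continuousOn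
  exact ⟨hc, C, fun η => hC η (Set.mem_univ _)⟩

/-- Differentiation under the integral sign along a one-parameter group of rotations. -/
lemma hasDerivAt_integral_rotation {A : E3 →L[ℝ] E3} (hA : IsSkewMap A) {F : E3 → ℝ}
    (hF : ∀ η : UnitSphere, ContDiffAt ℝ 1 F η) {w : UnitSphere → ℝ}
    (hw : Integrable w surfaceMeasure) :
    HasDerivAt (fun s => ∫ η, w η * F (hA.rotation s η) ∂surfaceMeasure)
      (∫ η, w η * fderiv ℝ F η (A η) ∂surfaceMeasure) 0 := by
  obtain ⟨hc, C, hC⟩ := exists_bound_fderiv hF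
  have hFc : Continuous (fun η : UnitSphere => F η) := by
    rw [continuous_iff_continuousAt]
    intro η
    exact ContinuousAt.comp (f := fun η : UnitSphere => (η : E3)) (hF η).continuousAt
      continuous_subtype_val.continuousAt
  have hFs : ∀ s, Continuous (fun η : UnitSphere => F (hA.rotation s η)) := fun s =>
    hFc.comp (sphereHomeomorph (hA.rotation s)).continuous
  have hF's : Continuous fun η : UnitSphere => fderiv ℝ F η (A η) := by fun_prop
  obtain ⟨K, hK⟩ := isCompact_univ.exists_bound_of_continuousOn (hFs 0).continuousOn
  have key := hasDerivAt_integral_of_dominated_loc_of_deriv_le (μ := surfaceMeasure)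
    (F := fun s η => w η * F (hA.rotation s η))
    (F' := fun s η => w η * fderiv ℝ F (hA.rotation s η) (A (hA.rotation s η)))
    (x₀ := (0 : ℝ)) (s := Set.univ) (bound := fun η => ‖w η‖ * (C * ‖A‖)) univ_mem
    (Eventually.of_forall fun s => hw.aestronglyMeasurable.mul (hFs s).aestronglyMeasurable)
    (hw.mul_bdd (c := K) (hFs 0).aestronglyMeasurable
      (Eventually.of_forall fun η => hK η (Set.mem_univ _)))
    (by
      simp only [hA.rotation_zero]
      exact hw.aestronglyMeasurable.mul hF's.aestronglyMeasurable)
    (Eventually.of_forall fun η s _ => by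
      rw [norm_mul]
      refine mul_le_mul_of_nonneg_left ?_ (norm_nonneg _)
      refine (ContinuousLinearMap.le_opNorm _ _).trans ?_
      have h1 : ‖A (hA.rotation s η)‖ ≤ ‖A‖ := by
        simpa using A.le_opNorm (hA.rotation s η)
      exact mul_le_mul (hC (sphereHomeomorph (hA.rotation s) η)) h1 (norm_nonneg _)
        ((norm_nonneg _).trans (hC η)))
    (hw.norm.mul_const _)
    (Eventually.of_forall fun η s _ => by
      refine HasDerivAt.const_mul (w η) ?_
      exact (((hF (sphereHomeomorph (hA.rotation s) η)).differentiableAt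
        (by norm_num)).hasFDerivAt).comp_hasDerivAt s (hA.hasDerivAt_rotation (η : E3) s))
  simpa only [hA.rotation_zero] using key.2

/-- The integral of `F` over the rotated sphere does not depend on the angle; differentiate at angle
zero. -/
lemma integral_fderiv_skew_eq_zero {A : E3 →L[ℝ] E3} (hA : IsSkewMap A) {F : E3 → ℝ}
    (hF : ∀ η : UnitSphere, ContDiffAt ℝ 1 F η) :
    ∫ η : UnitSphere, fderiv ℝ F η (A η) ∂surfaceMeasure = 0 := by
  have h := hasDerivAt_integral_rotation hA hF (w := fun _ => 1) (integrable_const _)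
  simp only [one_mul] at h
  have h2 : (fun s => ∫ η : UnitSphere, F (hA.rotation s η) ∂surfaceMeasure) =
      fun _ => ∫ η : UnitSphere, F η ∂surfaceMeasure := by
    ext s
    exact integral_comp_sphereHomeomorph (hA.rotation s) (fun η => F η)
  rw [h2] at h
  exact h.unique (hasDerivAt_const _ _)

/-- Green's identity on the sphere for a zonal function with derivative profile `q`. -/
lemma integral_zonal_green {q q' : ℝ → ℝ} (hq : ∀ t ∈ Set.Icc (-1 : ℝ) 1, ContDiffAt ℝ 1 q t)
    (hq' : ∀ t ∈ Set.Icc (-1 : ℝ) 1, HasDerivAt q (q' t) t)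
    {f : E3 → ℝ} (hf : ∀ η : UnitSphere, ContDiffAt ℝ 1 f η) (ξ : UnitSphere) :
    ∫ η : UnitSphere, (q' ⟪(ξ : E3), η⟫ * (1 - ⟪(ξ : E3), η⟫ ^ 2)
        - 2 * ⟪(ξ : E3), η⟫ * q ⟪(ξ : E3), η⟫) * f η ∂surfaceMeasure =
      ∑ i, ∫ η : UnitSphere, q ⟪(ξ : E3), η⟫ * ⟪rotGen i ξ, (η : E3)⟫ *
        fderiv ℝ f η (rotGen i η) ∂surfaceMeasure := by
  have hmem : ∀ η : UnitSphere, ⟪(ξ : E3), (η : E3)⟫ ∈ Set.Icc (-1 : ℝ) 1 := fun η => by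
    have := abs_real_inner_le_norm (ξ : E3) (η : E3)
    simp only [norm_coe_unitSphere, mul_one] at this
    exact abs_le.1 this
  have hqc : ∀ η : UnitSphere, ContDiffAt ℝ 1 (fun y : E3 => q ⟪(ξ : E3), y⟫) η := fun η =>
    ContDiffAt.comp (η : E3) (hq _ (hmem η)) (innerSL ℝ (ξ : E3)).contDiff.contDiffAt
  -- `F i` is `f` times the rotational derivative of a primitive of `q` in the variable `⟪ξ, y⟫`.
  -- Summing the vanishing integrals of `L_i (F i)` gives the identity, since with `t = ⟪ξ, η⟫` the
  -- squares `⟪ξ, L_i η⟫ ^ 2` sum to `1 - t ^ 2` and the `⟪ξ, L_i (L_i η)⟫` to `-2 t`.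
  let F : Fin 3 → E3 → ℝ := fun i y => q ⟪(ξ : E3), y⟫ * ⟪(ξ : E3), rotGen i y⟫ * f y
  have hF : ∀ i, ∀ η : UnitSphere, ContDiffAt ℝ 1 (F i) η := fun i η =>
    ((hqc η).mul ((innerSL ℝ (ξ : E3)).comp (rotGen i)).contDiff.contDiffAt).mul (hf η)
  have hder : ∀ i, ∀ η : UnitSphere, fderiv ℝ (F i) η (rotGen i η) =
      (q' ⟪(ξ : E3), η⟫ * ⟪(ξ : E3), rotGen i η⟫ ^ 2 +
        q ⟪(ξ : E3), η⟫ * ⟪(ξ : E3), rotGen i (rotGen i η)⟫) * f η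
      + q ⟪(ξ : E3), η⟫ * ⟪(ξ : E3), rotGen i η⟫ * fderiv ℝ f η (rotGen i η) := by
    intro i η
    have h1 : HasFDerivAt (fun y : E3 => ⟪(ξ : E3), y⟫) (innerSL ℝ (ξ : E3)) (η : E3) :=
      (innerSL ℝ (ξ : E3)).hasFDerivAt
    have h2 := (hq' _ (hmem η)).comp_hasFDerivAt (η : E3) h1
    have h3 : HasFDerivAt (fun y : E3 => ⟪(ξ : E3), rotGen i y⟫)
        ((innerSL ℝ (ξ : E3)).comp (rotGen i)) (η : E3) :=
      ((innerSL ℝ (ξ : E3)).comp (rotGen i)).hasFDerivAt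
    have h4 := ((h2.mul h3).mul ((hf η).differentiableAt (by norm_num)).hasFDerivAt).fderiv
    have h5 : fderiv ℝ (F i) η = _ := h4
    rw [h5]
    simp
    ring
  have hsum : ∑ i, ∫ η : UnitSphere, fderiv ℝ (F i) η (rotGen i η) ∂surfaceMeasure = 0 :=
    Finset.sum_eq_zero fun i _ => integral_fderiv_skew_eq_zero (isSkewMap_rotGen i) (hF i)
  have hint : ∀ g : UnitSphere → ℝ, Continuous g → Integrable g surfaceMeasure := fun g hg =>
    hg.integrable_of_hasCompactSupport (HasCompactSupport.of_compactSpace _)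
  have hcF : ∀ i, Continuous fun η : UnitSphere => fderiv ℝ (F i) η (rotGen i η) := fun i => by
    have := (exists_bound_fderiv (hF i)).1
    fun_prop
  have hcf := (exists_bound_fderiv hf).1
  have hcq : Continuous fun η : UnitSphere => q ⟪(ξ : E3), η⟫ :=
    continuous_iff_continuousAt.2 fun η =>
      (hqc η).continuousAt.comp (f := fun η : UnitSphere => (η : E3))
        continuous_subtype_val.continuousAt
  have hcG : ∀ i, Continuous fun η : UnitSphere => q ⟪(ξ : E3), η⟫ * ⟪rotGen i ξ, (η : E3)⟫ *
      fderiv ℝ f η (rotGen i η) := fun i =>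
    (hcq.mul (by fun_prop)).mul (hcf.clm_apply (by fun_prop))
  have hpt : ∀ η : UnitSphere, (q' ⟪(ξ : E3), η⟫ * (1 - ⟪(ξ : E3), η⟫ ^ 2)
        - 2 * ⟪(ξ : E3), η⟫ * q ⟪(ξ : E3), η⟫) * f η =
      ∑ i, fderiv ℝ (F i) η (rotGen i η) + ∑ i, q ⟪(ξ : E3), η⟫ * ⟪rotGen i ξ, (η : E3)⟫ *
        fderiv ℝ f η (rotGen i η) := by
    intro η
    simp only [hder, isSkewMap_rotGen _ (ξ : E3), Finset.sum_add_distrib, ← Finset.sum_mul,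
      ← Finset.mul_sum, ← inner_sum, sum_rotGen_rotGen]
    have h6 := sum_inner_rotGen_mul (η : E3) ξ ξ
    simp only [norm_coe_unitSphere, real_inner_self_eq_norm_sq] at h6
    have h7 : ∑ i, ⟪(ξ : E3), rotGen i (η : E3)⟫ ^ 2 = 1 - ⟪(ξ : E3), (η : E3)⟫ ^ 2 := by
      simp only [real_inner_comm _ (ξ : E3), sq] at h6 ⊢
      linarith
    rw [h7, inner_smul_right]
    simp only [mul_neg, neg_mul, Finset.sum_neg_distrib]
    ring
  simp only [hpt]
  rw [integral_add (integrable_finsetSum _ fun i _ => hint _ (hcF i))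
    (integrable_finsetSum _ fun i _ => hint _ (hcG i)),
    integral_finsetSum _ fun i _ => hint _ (hcF i), hsum, zero_add,
    integral_finsetSum _ fun i _ => hint _ (hcG i)]

end IntegrationByParts

/-! ### The integrable majorant and bounds for the regularized kernel -/

section Estimates

/-- The integrable majorant `(1 - t) ^ (-3/4)` of all singular kernels. -/
noncomputable def singularWeight (t : ℝ) : ℝ := (1 - t) ^ (-(3 / 4) : ℝ)

lemma inner_unitSphere_mem (ξ η : UnitSphere) : ⟪(ξ : E3), (η : E3)⟫ ∈ Set.Icc (-1 : ℝ) 1 := by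
  have := abs_real_inner_le_norm (ξ : E3) (η : E3)
  simp only [norm_coe_unitSphere, mul_one] at this
  exact abs_le.1 this

lemma inner_unitSphere_eq_one_iff (ξ η : UnitSphere) : ⟪(ξ : E3), (η : E3)⟫ = 1 ↔ ξ = η := by
  rw [inner_eq_one_iff_of_norm_eq_one (norm_coe_unitSphere ξ) (norm_coe_unitSphere η), SetCoe.ext_iff]

lemma integrable_of_continuous_unitSphere {g : UnitSphere → ℝ} (hg : Continuous g) :
    Integrable g surfaceMeasure :=
  hg.integrable_of_hasCompactSupport (HasCompactSupport.of_compactSpace _)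

instance : NullSingletonClass surfaceMeasure := by
  refine ⟨fun ξ => ?_⟩
  rw [surfaceMeasure, Measure.toSphere_apply' _ (measurableSet_singleton ξ)]
  have hs : (ℝ ∙ (ξ : E3)) ≠ ⊤ := by
    intro h
    have h1 := finrank_span_singleton (K := ℝ) (ne_zero_of_mem_unit_sphere ξ)
    rw [h, finrank_top] at h1
    simp at h1
  have h0 := Measure.addHaar_submodule (volume : Measure E3) (ℝ ∙ (ξ : E3)) hs
  rw [measure_mono_null _ h0, mul_zero]
  rintro _ ⟨r, -, _, ⟨η, hη, rfl⟩, rfl⟩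
  rw [Set.mem_singleton_iff.1 hη]
  exact Submodule.smul_mem _ _ (Submodule.mem_span_singleton_self _)

lemma ae_inner_lt_one (ξ : UnitSphere) : ∀ᵐ η : UnitSphere ∂surfaceMeasure, ⟪(ξ : E3), (η : E3)⟫ < 1 := by
  have : ∀ᵐ η : UnitSphere ∂surfaceMeasure, η ≠ ξ := by
    simp [ae_iff]
  filter_upwards [this] with η hη
  refine lt_of_le_of_ne (inner_unitSphere_mem ξ η).2 fun h => hη ?_
  exact ((inner_unitSphere_eq_one_iff ξ η).1 h).symm

/-- Green's identity with `f = 1` and `q` the weight itself makes a certain integral vanish, and its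
integrand is at most `6 - q / 2`. This bounds the integral of `q` uniformly in `ε` without spherical
coordinates. -/
lemma integral_regularized_weight_le {ε : ℝ} (hε : 0 < ε) (hε1 : ε ≤ 1) (ξ : UnitSphere) :
    ∫ η : UnitSphere, (1 + ε - ⟪(ξ : E3), η⟫) ^ (-(3 / 4) : ℝ) ∂surfaceMeasure ≤
      12 * (4 * Real.pi) := by
  have hpos : ∀ t ∈ Set.Icc (-1 : ℝ) 1, 0 < 1 + ε - t := fun t ht => by linarith [ht.2]
  have hq' : ∀ t ∈ Set.Icc (-1 : ℝ) 1, HasDerivAt (fun t : ℝ => (1 + ε - t) ^ (-(3 / 4) : ℝ))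
      (3 / 4 * (1 + ε - t) ^ (-(7 / 4) : ℝ)) t := fun t ht => by
    have h := ((hasDerivAt_id t).const_sub (1 + ε)).rpow_const (p := (-(3 / 4) : ℝ))
      (Or.inl (hpos t ht).ne')
    refine h.congr_deriv ?_
    norm_num [id]
  have h := integral_zonal_green (q := fun t => (1 + ε - t) ^ (-(3 / 4) : ℝ))
    (fun t ht => (contDiffAt_const.sub contDiffAt_id).rpow_const_of_ne (hpos t ht).ne') hq'
    (f := fun _ => 1) (fun _ => contDiffAt_const) ξ
  simp only [fderiv_fun_const, Pi.zero_apply, zero_apply, mul_zero,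
    integral_zero, Finset.sum_const_zero, mul_one] at h
  have hcr : ∀ p : ℝ, Continuous fun η : UnitSphere => (1 + ε - ⟪(ξ : E3), (η : E3)⟫) ^ p :=
    fun p => Continuous.rpow_const (by fun_prop)
      fun η => Or.inl (hpos _ (inner_unitSphere_mem ξ η)).ne'
  have hle : ∫ η : UnitSphere, (3 / 4 * (1 + ε - ⟪(ξ : E3), η⟫) ^ (-(7 / 4) : ℝ) *
      (1 - ⟪(ξ : E3), η⟫ ^ 2) - 2 * ⟪(ξ : E3), η⟫ * (1 + ε - ⟪(ξ : E3), η⟫) ^ (-(3 / 4) : ℝ))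
      ∂surfaceMeasure ≤ ∫ η : UnitSphere,
        (6 - 1 / 2 * (1 + ε - ⟪(ξ : E3), η⟫) ^ (-(3 / 4) : ℝ)) ∂surfaceMeasure := by
    refine integral_mono (integrable_of_continuous_unitSphere ?_)
      (integrable_of_continuous_unitSphere ?_) fun η => ?_
    · exact (((hcr _).const_mul _).mul (by fun_prop)).sub ((by fun_prop : Continuous
        fun η : UnitSphere => 2 * ⟪(ξ : E3), (η : E3)⟫).mul (hcr _))
    · exact continuous_const.sub ((hcr _).const_mul _)
    · have ht := inner_unitSphere_mem ξ η
      dsimp only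
      generalize ⟪(ξ : E3), (η : E3)⟫ = t at ht ⊢
      have hs := hpos t ht
      -- The derivative term is at most `(3/2) q`, because `1 - t ^ 2 ≤ 2 s`; and `-2 t q = -2 q + 2
      -- (1 - t) q ≤ -2 q + 6`, because `(1 - t) q ≤ s ^ (1/4) ≤ 3`.
      obtain ⟨s, hsdef⟩ : ∃ s, s = 1 + ε - t := ⟨_, rfl⟩
      rw [← hsdef] at hs ⊢
      have e1 : s ^ (-(3 / 4) : ℝ) = s ^ (-(7 / 4) : ℝ) * s := by
        rw [← Real.rpow_add_one hs.ne']; norm_num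
      have e2 : s ^ (1 / 4 : ℝ) = s ^ (-(3 / 4) : ℝ) * s := by
        rw [← Real.rpow_add_one hs.ne']; norm_num
      have h1 : 0 < s ^ (-(7 / 4) : ℝ) := Real.rpow_pos_of_pos hs _
      have h2 : 0 < s ^ (-(3 / 4) : ℝ) := Real.rpow_pos_of_pos hs _
      have h3 : s ^ (1 / 4 : ℝ) ≤ 3 := by
        calc s ^ (1 / 4 : ℝ) ≤ 3 ^ (1 / 4 : ℝ) :=
              Real.rpow_le_rpow hs.le (by linarith [ht.1]) (by norm_num)
          _ ≤ 3 ^ (1 : ℝ) := Real.rpow_le_rpow_of_exponent_le (by norm_num) (by norm_num)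
          _ = 3 := Real.rpow_one 3
      have h4 : s ^ (-(7 / 4) : ℝ) * (1 - t ^ 2) ≤ s ^ (-(7 / 4) : ℝ) * (2 * s) := by
        refine mul_le_mul_of_nonneg_left ?_ h1.le
        nlinarith [ht.1, ht.2]
      have h5 : s ^ (-(3 / 4) : ℝ) * (1 - t) ≤ s ^ (-(3 / 4) : ℝ) * s :=
        mul_le_mul_of_nonneg_left (by linarith) h2.le
      nlinarith
  rw [h, integral_sub (integrable_const _)
    (integrable_of_continuous_unitSphere ((hcr _).const_mul _)), integral_const,
    integral_const_mul, surfaceMeasure_univ, smul_eq_mul] at hle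
  linarith

/-- Fatou's lemma applied to the uniformly bounded regularized integrals. -/
lemma integrable_singularWeight_and_le (ξ : UnitSphere) :
    Integrable (fun η : UnitSphere => singularWeight ⟪(ξ : E3), η⟫) surfaceMeasure ∧
      ∫ η : UnitSphere, singularWeight ⟪(ξ : E3), η⟫ ∂surfaceMeasure ≤ 12 * (4 * Real.pi) := by
  have hmeas : Measurable fun η : UnitSphere => singularWeight ⟪(ξ : E3), η⟫ := by
    unfold singularWeight
    fun_prop
  have hnn : ∀ η : UnitSphere, 0 ≤ singularWeight ⟪(ξ : E3), η⟫ := fun η =>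
    Real.rpow_nonneg (by linarith [(inner_unitSphere_mem ξ η).2]) _
  let f : ℕ → UnitSphere → ℝ := fun n η =>
    (1 + 1 / ((n : ℝ) + 1) - ⟪(ξ : E3), η⟫) ^ (-(3 / 4) : ℝ)
  have hfnn : ∀ n η, 0 ≤ f n η := fun n η => Real.rpow_nonneg (by
    have : 0 < 1 / ((n : ℝ) + 1) := by positivity
    linarith [(inner_unitSphere_mem ξ η).2]) _
  have hfc : ∀ n, Continuous (f n) := fun n => Continuous.rpow_const (by fun_prop)
      fun η => Or.inl (by
        have : 0 < 1 / ((n : ℝ) + 1) := by positivity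
        linarith [(inner_unitSphere_mem ξ η).2])
  have hlim : ∀ᵐ η ∂surfaceMeasure, Tendsto (fun n => f n η) atTop
      (𝓝 (singularWeight ⟪(ξ : E3), η⟫)) := by
    filter_upwards [ae_inner_lt_one ξ] with η hη
    unfold singularWeight
    refine Tendsto.rpow_const ?_ (Or.inl (by linarith))
    have : Tendsto (fun n : ℕ => 1 + 1 / ((n : ℝ) + 1) - ⟪(ξ : E3), (η : E3)⟫) atTop
        (𝓝 (1 + 0 - ⟪(ξ : E3), (η : E3)⟫)) :=
      (tendsto_one_div_add_atTop_nhds_zero_nat.const_add 1).sub_const _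
    simpa using this
  have hle : ∫⁻ η : UnitSphere, ENNReal.ofReal (singularWeight ⟪(ξ : E3), η⟫) ∂surfaceMeasure ≤
      ENNReal.ofReal (12 * (4 * Real.pi)) := by
    calc _ = ∫⁻ η, liminf (fun n => ENNReal.ofReal (f n η)) atTop ∂surfaceMeasure := by
          refine lintegral_congr_ae ?_
          filter_upwards [hlim] with η hη
          exact ((ENNReal.continuous_ofReal.tendsto _).comp hη).liminf_eq.symm
      _ ≤ liminf (fun n => ∫⁻ η, ENNReal.ofReal (f n η) ∂surfaceMeasure) atTop :=
          lintegral_liminf_le fun n => (hfc n).measurable.ennreal_ofReal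
      _ ≤ liminf (fun _ : ℕ => ENNReal.ofReal (12 * (4 * Real.pi))) atTop := by
          refine liminf_le_liminf (Eventually.of_forall fun n => ?_)
          rw [← ofReal_integral_eq_lintegral_ofReal (integrable_of_continuous_unitSphere (hfc n))
            (Eventually.of_forall (hfnn n))]
          refine ENNReal.ofReal_le_ofReal (integral_regularized_weight_le (by positivity) ?_ ξ)
          rw [div_le_one (by positivity)]
          linarith [(Nat.cast_nonneg n : (0 : ℝ) ≤ n)]
      _ = _ := by simp
  have hint : Integrable (fun η : UnitSphere => singularWeight ⟪(ξ : E3), η⟫) surfaceMeasure := by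
    refine ⟨hmeas.aestronglyMeasurable, ?_⟩
    rw [hasFiniteIntegral_iff_ofReal (Eventually.of_forall hnn)]
    exact hle.trans_lt ENNReal.ofReal_lt_top
  refine ⟨hint, ?_⟩
  rw [integral_eq_lintegral_of_nonneg_ae (Eventually.of_forall hnn) hmeas.aestronglyMeasurable]
  exact ENNReal.toReal_le_of_le_ofReal (by positivity) hle

/-- The substitution `1 - t = u ^ 4` turns the fractional powers in the kernel estimates into
integer ones. -/
lemma singularWeight_one_sub_pow {u : ℝ} (hu : 0 ≤ u) :
    singularWeight (1 - u ^ 4) = (u ^ 3)⁻¹ := by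
  rw [singularWeight, sub_sub_cancel, ← Real.rpow_natCast u 4, ← Real.rpow_mul hu,
    ← Real.rpow_natCast u 3, ← Real.rpow_neg hu]
  norm_num

lemma exists_eq_one_sub_pow {t : ℝ} (ht : t ≤ 1) : ∃ u : ℝ, 0 ≤ u ∧ t = 1 - u ^ 4 := by
  refine ⟨(1 - t) ^ (1 / 4 : ℝ), Real.rpow_nonneg (by linarith) _, ?_⟩
  rw [← Real.rpow_natCast, ← Real.rpow_mul (by linarith)]
  norm_num

lemma abs_log_le {t ε : ℝ} (ht : t ∈ Set.Ico (-1 : ℝ) 1) (hε : 0 ≤ ε) (hε1 : ε ≤ 1) :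
    |Real.log (1 + ε - t)| ≤ 2 + 2 * singularWeight t := by
  obtain ⟨u, hu, rfl⟩ := exists_eq_one_sub_pow ht.2.le
  have hu0 : 0 < u := lt_of_le_of_ne hu (by rintro rfl; simp at ht)
  rw [singularWeight_one_sub_pow hu]
  have hu4 : 0 < u ^ 4 := by positivity
  have h1 : Real.log (1 + ε - (1 - u ^ 4)) ≤ 2 := by
    have := Real.log_le_sub_one_of_pos (x := 1 + ε - (1 - u ^ 4)) (by linarith)
    linarith [ht.1]
  have h2 : Real.log (u ^ 4) ≤ Real.log (1 + ε - (1 - u ^ 4)) :=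
    Real.log_le_log hu4 (by linarith)
  have h3 : -Real.log (u ^ 4) ≤ 2 * (u ^ 3)⁻¹ := by
    have := Real.log_le_sub_one_of_pos (x := (u ^ 3)⁻¹) (by positivity)
    rw [Real.log_inv, Real.log_pow] at this
    rw [Real.log_pow]
    have h4 : 0 < (u ^ 3)⁻¹ := by positivity
    push_cast at this ⊢
    linarith
  have h5 : 0 < (u ^ 3)⁻¹ := by positivity
  rw [abs_le]
  constructor <;> linarith

/-- The kernel `G(Δ*; t)` regularized by a shift of the singularity. -/
noncomputable def greenKernel (ε t : ℝ) : ℝ :=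
  1 / (4 * Real.pi) * Real.log (1 + ε - t) + 1 / (4 * Real.pi) * (1 - Real.log 2)

/-- The derivative of `greenKernel`. -/
noncomputable def greenKernelDeriv (ε t : ℝ) : ℝ := -(1 / (4 * Real.pi)) * (1 + ε - t)⁻¹

/-- The second derivative of `greenKernel`. -/
noncomputable def greenKernelDeriv2 (ε t : ℝ) : ℝ := -(1 / (4 * Real.pi)) * ((1 + ε - t) ^ 2)⁻¹

lemma greenKernel_zero : greenKernel 0 = fundamentalSolution := by
  ext t; simp [greenKernel, fundamentalSolution]

lemma hasDerivAt_greenKernel {ε t : ℝ} (h : t < 1 + ε) :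
    HasDerivAt (greenKernel ε) (greenKernelDeriv ε t) t := by
  have h1 := (((hasDerivAt_id t).const_sub (1 + ε)).log (by rw [id]; linarith)).const_mul
    (1 / (4 * Real.pi)) |>.add_const (1 / (4 * Real.pi) * (1 - Real.log 2))
  refine h1.congr_deriv ?_
  rw [greenKernelDeriv, id]
  ring

lemma hasDerivAt_greenKernelDeriv {ε t : ℝ} (h : t < 1 + ε) :
    HasDerivAt (greenKernelDeriv ε) (greenKernelDeriv2 ε t) t := by
  have h1 := (((hasDerivAt_id t).const_sub (1 + ε)).inv (by rw [id]; linarith)).const_mul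
    (-(1 / (4 * Real.pi)))
  refine h1.congr_deriv ?_
  rw [greenKernelDeriv2, id]
  ring

lemma measurable_greenKernel (ε : ℝ) : Measurable (greenKernel ε) := by
  unfold greenKernel; fun_prop

lemma measurable_greenKernelDeriv (ε : ℝ) : Measurable (greenKernelDeriv ε) := by
  unfold greenKernelDeriv; fun_prop

lemma measurable_greenKernelDeriv2 (ε : ℝ) : Measurable (greenKernelDeriv2 ε) := by
  unfold greenKernelDeriv2; fun_prop

lemma one_div_four_pi_bounds : 0 < 1 / (4 * Real.pi) ∧ 1 / (4 * Real.pi) ≤ 1 / 12 := by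
  refine ⟨by positivity, ?_⟩
  apply one_div_le_one_div_of_le <;> linarith [Real.pi_gt_three]

lemma abs_greenKernel_le {t ε : ℝ} (ht : t ∈ Set.Ico (-1 : ℝ) 1) (hε : 0 ≤ ε) (hε1 : ε ≤ 1) :
    |greenKernel ε t| ≤ 1 + singularWeight t := by
  obtain ⟨h1, h2⟩ := one_div_four_pi_bounds
  have h3 := abs_log_le ht hε hε1
  have h4 : 0 ≤ singularWeight t := Real.rpow_nonneg (by linarith [ht.2]) _
  have h5 : |1 - Real.log 2| ≤ 1 := by
    have := Real.log_two_gt_d9; have := Real.log_two_lt_d9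
    rw [abs_le]; constructor <;> linarith
  unfold greenKernel
  refine (abs_add_le _ _).trans ?_
  rw [abs_mul, abs_mul, abs_of_pos h1]
  nlinarith [abs_nonneg (Real.log (1 + ε - t)), abs_nonneg (1 - Real.log 2)]

/-- Here `r` will be the length of the tangential part of `η`, of order `(1 - t) ^ (1/2)`. It lowers
the singularity `(1 - t)⁻¹` to order `-1/2`, which the weight dominates. -/
lemma abs_greenKernelDeriv_mul_le {t ε r : ℝ} (ht : t ≤ 1) (hε : 0 ≤ ε) (hr : 0 ≤ r)
    (hr2 : r ^ 2 ≤ 2 * (1 - t)) (ht1 : -1 ≤ t) :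
    |greenKernelDeriv ε t| * r ≤ singularWeight t := by
  obtain ⟨u, hu, rfl⟩ := exists_eq_one_sub_pow ht
  obtain ⟨h1, h2⟩ := one_div_four_pi_bounds
  rw [singularWeight_one_sub_pow hu, greenKernelDeriv, abs_mul, abs_neg, abs_of_pos h1]
  have hr3 : r ≤ 2 * u ^ 2 := by
    apply le_of_sq_le_sq _ (by positivity)
    nlinarith [sq_nonneg (u ^ 2)]
  rcases hu.eq_or_lt with rfl | hu0
  · have : r = 0 := by simpa using le_antisymm (by simpa using hr3) hr
    simp [this]
  have hu4 : 0 < u ^ 4 := by positivity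
  have h3 : |(1 + ε - (1 - u ^ 4))⁻¹| ≤ (u ^ 4)⁻¹ := by
    rw [abs_of_nonneg (inv_nonneg.2 (by linarith))]
    exact inv_anti₀ hu4 (by linarith)
  have hu2 : u ≤ 2 := by
    by_contra h
    push Not at h
    have : (2 : ℝ) ^ 4 < u ^ 4 := pow_lt_pow_left₀ h (by norm_num) (by norm_num)
    linarith
  calc 1 / (4 * Real.pi) * |(1 + ε - (1 - u ^ 4))⁻¹| * r ≤ 1 / 12 * (u ^ 4)⁻¹ * (2 * u ^ 2) := by
        gcongr
    _ = 1 / 6 * u * (u ^ 3)⁻¹ := by field_simp; ring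
    _ ≤ 1 * (u ^ 3)⁻¹ := by
        gcongr; linarith
    _ = _ := one_mul _

/-- The weight's exponent lies between the gradient's `-1/2` and the integrability limit `-1`. The
spare quarter power pays for the rate `s = ε ^ (1/4)`, uniform in `t`. -/
lemma abs_greenKernelDeriv_sub_mul_le {t s r : ℝ} (ht : t ≤ 1) (hs : 0 < s) (hr : 0 ≤ r)
    (hr2 : r ^ 2 ≤ 2 * (1 - t)) :
    |greenKernelDeriv (s ^ 4) t - greenKernelDeriv 0 t| * r ≤ s * singularWeight t := by
  obtain ⟨u, hu, rfl⟩ := exists_eq_one_sub_pow ht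
  obtain ⟨h1, h2⟩ := one_div_four_pi_bounds
  rw [singularWeight_one_sub_pow hu]
  have hr3 : r ≤ 2 * u ^ 2 := by
    apply le_of_sq_le_sq _ (by positivity)
    nlinarith [sq_nonneg (u ^ 2)]
  rcases hu.eq_or_lt with rfl | hu0
  · have : r = 0 := by simpa using le_antisymm (by simpa using hr3) hr
    simp [this]
  have h3 : greenKernelDeriv (s ^ 4) (1 - u ^ 4) - greenKernelDeriv 0 (1 - u ^ 4) =
      1 / (4 * Real.pi) * (s ^ 4 / (u ^ 4 * (s ^ 4 + u ^ 4))) := by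
    have e1 : 1 + s ^ 4 - (1 - u ^ 4) = s ^ 4 + u ^ 4 := by ring
    have e2 : 1 + 0 - (1 - u ^ 4) = u ^ 4 := by ring
    rw [greenKernelDeriv, greenKernelDeriv, e1, e2]
    have : s ^ 4 + u ^ 4 ≠ 0 := by positivity
    field_simp
    ring
  rw [h3, abs_of_nonneg (by positivity)]
  -- Once `s * (u ^ 3)⁻¹` is split off, the quotient of `s ^ 3 * u` by `s ^ 4 + u ^ 4` remains,
  -- homogeneous of degree zero and hence bounded.
  have h4 : s ^ 3 * u ≤ 2 * (s ^ 4 + u ^ 4) := by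
    nlinarith [sq_nonneg (s ^ 2 - s * u), sq_nonneg (s * u - u ^ 2), sq_nonneg (s ^ 2 - u ^ 2),
      sq_nonneg (s * u), sq_nonneg (s ^ 2), sq_nonneg (u ^ 2)]
  calc 1 / (4 * Real.pi) * (s ^ 4 / (u ^ 4 * (s ^ 4 + u ^ 4))) * r
      ≤ 1 / 12 * (s ^ 4 / (u ^ 4 * (s ^ 4 + u ^ 4))) * (2 * u ^ 2) := by gcongr
    _ = 1 / 6 * ((s ^ 3 * u) / (s ^ 4 + u ^ 4)) * (s * (u ^ 3)⁻¹) := by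
        have : s ^ 4 + u ^ 4 ≠ 0 := by positivity
        field_simp; ring
    _ ≤ 1 / 6 * 2 * (s * (u ^ 3)⁻¹) := by
        gcongr
        rwa [div_le_iff₀ (by positivity)]
    _ ≤ s * (u ^ 3)⁻¹ := by
        have : 0 < s * (u ^ 3)⁻¹ := by positivity
        linarith

end Estimates

/-! ### The radial projection and its derivative -/

section Normalization

/-- The radial projection `x ↦ x / |x|`. -/
noncomputable def nrm (x : E3) : E3 := ‖x‖⁻¹ • x

/-- The derivative of the radial projection. -/
noncomputable def nrmDeriv (x : E3) : E3 →L[ℝ] E3 :=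
  ‖x‖⁻¹ • (ContinuousLinearMap.id ℝ E3 - (innerSL ℝ (nrm x)).smulRight (nrm x))

lemma nrmDeriv_apply (x v : E3) : nrmDeriv x v = ‖x‖⁻¹ • (v - ⟪nrm x, v⟫ • nrm x) := by
  simp [nrmDeriv]

lemma nrm_coe (ξ : UnitSphere) : nrm ξ = ξ := by simp [nrm]

lemma norm_nrm {x : E3} (hx : x ≠ 0) : ‖nrm x‖ = 1 := by
  simp [nrm, norm_smul, hx]

lemma exists_coe_eq_nrm {x : E3} (hx : x ≠ 0) : ∃ ξ : UnitSphere, (ξ : E3) = nrm x :=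
  ⟨⟨nrm x, by simp [norm_nrm hx]⟩, rfl⟩

lemma hasFDerivAt_nrm {x : E3} (hx : x ≠ 0) : HasFDerivAt nrm (nrmDeriv x) x := by
  have hx' : ‖x‖ ≠ 0 := norm_ne_zero_iff.2 hx
  have h1 := (hasStrictFDerivAt_norm_sq x).hasFDerivAt.sqrt (by positivity)
  have h2 : HasFDerivAt (fun y : E3 => ‖y‖) (‖x‖⁻¹ • innerSL ℝ x) x := by
    have : (fun y : E3 => Real.sqrt (‖y‖ ^ 2)) = fun y => ‖y‖ := by
      ext y; exact Real.sqrt_sq (norm_nonneg y)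
    rw [this] at h1
    refine h1.congr_fderiv ?_
    rw [Real.sqrt_sq (norm_nonneg x)]
    ext v
    simp
    ring
  have h3 := ((hasDerivAt_inv hx').comp_hasFDerivAt x h2).smul (hasFDerivAt_id x)
  refine h3.congr_fderiv ?_
  ext1 v
  simp only [nrmDeriv_apply, nrm]
  simp [inner_smul_left, smul_smul, sub_eq_add_neg]
  ring_nf

lemma contDiffAt_nrm {x : E3} (hx : x ≠ 0) {k : ℕ∞ω} : ContDiffAt ℝ k nrm x :=
  ((contDiffAt_norm ℝ hx).inv (norm_ne_zero_iff.2 hx)).smul contDiffAt_id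

lemma continuousAt_nrmDeriv {x : E3} (hx : x ≠ 0) : ContinuousAt nrmDeriv x := by
  have h := (contDiffAt_nrm hx (k := 0)).continuousAt
  have hx' : ‖x‖ ≠ 0 := norm_ne_zero_iff.2 hx
  have h1 : ContinuousAt (fun y : E3 => ‖y‖⁻¹) x := continuousAt_id.norm.inv₀ hx'
  have h2 : ContinuousAt (fun y : E3 => (innerSL ℝ (nrm y)).smulRight (nrm y)) x := by
    have h3 : ContinuousAt (fun y : E3 => innerSL ℝ (nrm y)) x :=
      (innerSL ℝ).continuous.continuousAt.comp h
    have h4 : ContinuousAt (fun y : E3 => ContinuousLinearMap.smulRightL ℝ E3 E3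
      (innerSL ℝ (nrm y))) x :=
      (ContinuousLinearMap.smulRightL ℝ E3 E3).continuous.continuousAt.comp h3
    exact h4.clm_apply h
  exact h1.smul (continuousAt_const.sub h2)

lemma inner_nrmDeriv_comm (x v w : E3) : ⟪nrmDeriv x v, w⟫ = ⟪v, nrmDeriv x w⟫ := by
  simp only [nrmDeriv_apply, inner_smul_left, inner_smul_right, inner_sub_left, inner_sub_right,
    real_inner_comm (nrm x)]
  simp
  ring_nf
  simp

lemma IsSkewMap.nrmDeriv_apply {A : E3 →L[ℝ] E3} (hA : IsSkewMap A) (x : E3) :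
    nrmDeriv x (A x) = A (nrm x) := by
  have : ⟪nrm x, A x⟫ = 0 := by simp [nrm, inner_smul_left, hA.inner_self]
  rw [_root_.nrmDeriv_apply, this]
  simp [nrm]

/-- By Lagrange's identity the fields `rotGen i x` resolve the tangential projection, although the
three of them are linearly dependent. -/
lemma nrmDeriv_eq_sum {x : E3} (hx : x ≠ 0) (v : E3) :
    nrmDeriv x v = (‖x‖ ^ 2)⁻¹ • ∑ i, ⟪rotGen i x, v⟫ • rotGen i (nrm x) := by
  have hx' : ‖x‖ ≠ 0 := norm_ne_zero_iff.2 hx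
  refine ext_inner_right ℝ fun w => ?_
  have h := sum_inner_rotGen_mul x v w
  simp only [nrmDeriv_apply, nrm, map_smul, inner_smul_left, sum_inner, inner_sub_left]
  have : ∑ i, (starRingEnd ℝ) ⟪rotGen i x, v⟫ * ((starRingEnd ℝ) ‖x‖⁻¹ * ⟪rotGen i x, w⟫) =
      ‖x‖⁻¹ * ∑ i, ⟪rotGen i x, v⟫ * ⟪rotGen i x, w⟫ := by
    rw [Finset.mul_sum]
    refine Finset.sum_congr rfl fun i _ => ?_
    simp
    ring
  rw [this, h]
  simp
  field_simp

/-- The left side is the squared length `1 - t ^ 2 = (1 - t) (1 + t)` of the tangential part of `η`.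
-/
lemma norm_nrmDeriv_sq {x : E3} (hx : x ≠ 0) (η : UnitSphere) :
    (‖x‖ * ‖nrmDeriv x η‖) ^ 2 ≤ 2 * (1 - ⟪nrm x, (η : E3)⟫) := by
  have hx' : ‖x‖ ≠ 0 := norm_ne_zero_iff.2 hx
  obtain ⟨ξ, hξ⟩ := exists_coe_eq_nrm hx
  have ht := inner_unitSphere_mem ξ η
  rw [hξ] at ht
  rw [nrmDeriv_apply, norm_smul, norm_inv, norm_norm, mul_inv_cancel_left₀ hx',
    @norm_sub_sq_real, norm_smul, norm_nrm hx, inner_smul_right,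
    real_inner_comm (nrm x) (η : E3), norm_coe_unitSphere, mul_one, Real.norm_eq_abs, sq_abs]
  nlinarith [ht.1, ht.2]

end Normalization

/-! ### Differentiation under the integral for kernels regular on the support of the density -/

section DifferentiationUnderIntegral

/-- Differentiation under the integral sign over the sphere for a kernel that is of class `C¹` with
uniform bounds on the support of the density. -/
lemma hasFDerivAt_integral_kernel {K : E3 → UnitSphere → ℝ} {K' : E3 → UnitSphere → E3 →L[ℝ] ℝ}
    {g : UnitSphere → ℝ} {B : Set E3} (hB : IsOpen B)
    (hKm : ∀ x ∈ B, AEStronglyMeasurable (K x) surfaceMeasure)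
    (hK'm : ∀ x ∈ B, AEStronglyMeasurable (K' x) surfaceMeasure)
    (hg : Integrable g surfaceMeasure) {C : ℝ}
    (hKb : ∀ x ∈ B, ∀ η, g η ≠ 0 → |K x η| ≤ C) (hK'b : ∀ x ∈ B, ∀ η, g η ≠ 0 → ‖K' x η‖ ≤ C)
    (hd : ∀ η, g η ≠ 0 → ∀ x ∈ B, HasFDerivAt (fun x => K x η) (K' x η) x)
    (hc : ∀ η, g η ≠ 0 → ContinuousOn (fun x => K' x η) B) :
    (∀ x ∈ B, HasFDerivAt (fun x => ∫ η, K x η * g η ∂surfaceMeasure)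
      (∫ η, g η • K' x η ∂surfaceMeasure) x) ∧
    ContinuousOn (fun x => ∫ η, g η • K' x η ∂surfaceMeasure) B := by
  have hbd : ∀ η, ∀ x ∈ B, ‖g η • K' x η‖ ≤ ‖g η‖ * C := fun η x hx => by
    rw [norm_smul]
    by_cases h : g η = 0
    · simp [h]
    · exact mul_le_mul_of_nonneg_left (hK'b x hx η h) (norm_nonneg _)
  constructor
  · intro x hx
    refine hasFDerivAt_integral_of_dominated_of_fderiv_le (F := fun x η => K x η * g η)
      (F' := fun x η => g η • K' x η) (bound := fun η => ‖g η‖ * C) (hB.mem_nhds hx) ?_ ?_ ?_ ?_ ?_ ?_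
    · filter_upwards [hB.mem_nhds hx] with y hy
      exact (hKm y hy).mul hg.aestronglyMeasurable
    · refine (hg.norm.mul_const C).mono' ((hKm x hx).mul hg.aestronglyMeasurable)
        (Eventually.of_forall fun η => ?_)
      rw [norm_mul, mul_comm]
      by_cases h : g η = 0
      · simp [h]
      · exact mul_le_mul_of_nonneg_left (hKb x hx η h) (norm_nonneg _)
    · exact hg.aestronglyMeasurable.smul (hK'm x hx)
    · exact Eventually.of_forall hbd
    · exact hg.norm.mul_const C
    · refine Eventually.of_forall fun η y hy => ?_
      by_cases h : g η = 0
      · simpa [h] using hasFDerivAt_const (0 : ℝ) y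
      · exact (hd η h y hy).mul_const (g η)
  · refine continuousOn_of_dominated (bound := fun η => ‖g η‖ * C)
      (fun x hx => hg.aestronglyMeasurable.smul (hK'm x hx))
      (fun x hx => Eventually.of_forall fun η => hbd η x hx) (hg.norm.mul_const C)
      (Eventually.of_forall fun η => ?_)
    by_cases h : g η = 0
    · simpa [h] using continuousOn_const
    · exact (hc η h).const_smul (g η)

end DifferentiationUnderIntegral

/-! ### The potential of a bounded density is continuously differentiable -/

section Potential

/-- The potential of the density `g` with kernel `greenKernel ε`, constant along rays. -/
noncomputable def potential (ε : ℝ) (g : UnitSphere → ℝ) (x : E3) : ℝ :=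
  ∫ η : UnitSphere, greenKernel ε ⟪nrm x, (η : E3)⟫ * g η ∂surfaceMeasure

/-- The derivative of the potential along the infinitesimal rotation `A`. -/
noncomputable def rotPotential (ε : ℝ) (A : E3 →L[ℝ] E3) (g : UnitSphere → ℝ) (x : E3) : ℝ :=
  ∫ η : UnitSphere, greenKernelDeriv ε ⟪nrm x, (η : E3)⟫ * ⟪A (nrm x), (η : E3)⟫ * g η
    ∂surfaceMeasure

/-- The Fréchet derivative of the kernel of the potential. -/
noncomputable def potentialKernelDeriv (ε : ℝ) (x : E3) (η : UnitSphere) : E3 →L[ℝ] ℝ :=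
  greenKernelDeriv ε ⟪nrm x, (η : E3)⟫ • innerSL ℝ (nrmDeriv x η)

/-- The Fréchet derivative of the potential. -/
noncomputable def potentialDeriv (ε : ℝ) (g : UnitSphere → ℝ) (x : E3) : E3 →L[ℝ] ℝ :=
  ∫ η : UnitSphere, g η • potentialKernelDeriv ε x η ∂surfaceMeasure

lemma integrable_of_bounded {g : UnitSphere → ℝ} (hg : Measurable g) {M : ℝ}
    (hM : ∀ η, |g η| ≤ M) : Integrable g surfaceMeasure :=
  Integrable.of_bound hg.aestronglyMeasurable M (Eventually.of_forall hM)

lemma integrable_greenKernel {ε : ℝ} (hε : 0 ≤ ε) (hε1 : ε ≤ 1) (ξ : UnitSphere) :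
    Integrable (fun η : UnitSphere => greenKernel ε ⟪(ξ : E3), (η : E3)⟫) surfaceMeasure := by
  refine ((integrable_const (1 : ℝ)).add (integrable_singularWeight_and_le ξ).1).mono'
    ((measurable_greenKernel ε).comp (by fun_prop)).aestronglyMeasurable ?_
  filter_upwards [ae_inner_lt_one ξ] with η hη
  exact abs_greenKernel_le ⟨(inner_unitSphere_mem ξ η).1, hη⟩ hε hε1

lemma integrable_greenKernel_mul {ε : ℝ} (hε : 0 ≤ ε) (hε1 : ε ≤ 1) {g : UnitSphere → ℝ}
    (hg : Measurable g) {M : ℝ} (hM : ∀ η, |g η| ≤ M) (ξ : UnitSphere) :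
    Integrable (fun η : UnitSphere => greenKernel ε ⟪(ξ : E3), (η : E3)⟫ * g η) surfaceMeasure :=
  (integrable_greenKernel hε hε1 ξ).mul_bdd hg.aestronglyMeasurable (Eventually.of_forall hM)

lemma measurable_potentialKernelDeriv (ε : ℝ) (x : E3) : Measurable (potentialKernelDeriv ε x) := by
  unfold potentialKernelDeriv
  refine Measurable.smul ((measurable_greenKernelDeriv ε).comp (by fun_prop)) ?_
  exact Continuous.measurable (by fun_prop)

lemma norm_potentialKernelDeriv_le {ε : ℝ} (hε : 0 ≤ ε) {x : E3} (hx : x ≠ 0) (η : UnitSphere) :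
    ‖potentialKernelDeriv ε x η‖ ≤ ‖x‖⁻¹ * singularWeight ⟪nrm x, (η : E3)⟫ := by
  obtain ⟨ξ, hξ⟩ := exists_coe_eq_nrm hx
  have ht := inner_unitSphere_mem ξ η
  rw [hξ] at ht
  have h := abs_greenKernelDeriv_mul_le ht.2 hε (by positivity) (norm_nrmDeriv_sq hx η) ht.1
  have hx' : 0 < ‖x‖ := norm_pos_iff.2 hx
  rw [potentialKernelDeriv, norm_smul, innerSL_apply_norm, Real.norm_eq_abs]
  rw [le_inv_mul_iff₀ hx']
  linarith

lemma integrable_potentialKernelDeriv {ε : ℝ} (hε : 0 ≤ ε) {g : UnitSphere → ℝ}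
    (hg : Measurable g) {M : ℝ} (hM : ∀ η, |g η| ≤ M) {x : E3} (hx : x ≠ 0) :
    Integrable (fun η => g η • potentialKernelDeriv ε x η) surfaceMeasure := by
  obtain ⟨ξ, hξ⟩ := exists_coe_eq_nrm hx
  have hw := (integrable_singularWeight_and_le ξ).1
  rw [hξ] at hw
  refine ((hw.const_mul ‖x‖⁻¹).const_mul M).mono'
    (hg.smul (measurable_potentialKernelDeriv ε x)).aestronglyMeasurable
    (Eventually.of_forall fun η => ?_)
  rw [norm_smul]
  exact mul_le_mul (hM η) (norm_potentialKernelDeriv_le hε hx η) (norm_nonneg _)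
    ((abs_nonneg _).trans (hM η))

lemma potentialKernelDeriv_apply_skew (ε : ℝ) {A : E3 →L[ℝ] E3} (hA : IsSkewMap A) (x : E3)
    (η : UnitSphere) : potentialKernelDeriv ε x η (A x) =
      greenKernelDeriv ε ⟪nrm x, (η : E3)⟫ * ⟪A (nrm x), (η : E3)⟫ := by
  have h : ⟪A (nrm x), (η : E3)⟫ = ⟪nrmDeriv x η, A x⟫ := by
    rw [← hA.nrmDeriv_apply, inner_nrmDeriv_comm, real_inner_comm]
  rw [h]
  rfl

lemma potentialKernelDeriv_apply (ε : ℝ) {x : E3} (hx : x ≠ 0) (v : E3) (η : UnitSphere) :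
    potentialKernelDeriv ε x η v = (‖x‖ ^ 2)⁻¹ * ∑ i, ⟪rotGen i x, v⟫ *
      (greenKernelDeriv ε ⟪nrm x, (η : E3)⟫ * ⟪rotGen i (nrm x), (η : E3)⟫) := by
  simp only [potentialKernelDeriv, smul_apply, innerSL_apply_apply,
    inner_nrmDeriv_comm, nrmDeriv_eq_sum hx v, inner_smul_right, inner_sum, smul_eq_mul,
    Finset.mul_sum, real_inner_comm (η : E3)]
  refine Finset.sum_congr rfl fun i _ => ?_
  rw [real_inner_comm (rotGen i (nrm x))]
  ring

lemma integrable_rotPotential {ε : ℝ} (hε : 0 ≤ ε) {A : E3 →L[ℝ] E3} (hA : IsSkewMap A)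
    {g : UnitSphere → ℝ} (hg : Measurable g) {M : ℝ} (hM : ∀ η, |g η| ≤ M) {x : E3} (hx : x ≠ 0) :
    Integrable (fun η : UnitSphere => greenKernelDeriv ε ⟪nrm x, (η : E3)⟫ *
      ⟪A (nrm x), (η : E3)⟫ * g η) surfaceMeasure := by
  have h := (integrable_potentialKernelDeriv hε hg hM hx).apply_continuousLinearMap (A x)
  refine h.congr (Eventually.of_forall fun η => ?_)
  simp [potentialKernelDeriv_apply_skew ε hA, mul_comm]

lemma potentialDeriv_apply_skew {ε : ℝ} (hε : 0 ≤ ε) {A : E3 →L[ℝ] E3} (hA : IsSkewMap A)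
    {g : UnitSphere → ℝ} (hg : Measurable g) {M : ℝ} (hM : ∀ η, |g η| ≤ M) {x : E3} (hx : x ≠ 0) :
    potentialDeriv ε g x (A x) = rotPotential ε A g x := by
  rw [potentialDeriv, ContinuousLinearMap.integral_apply
    (integrable_potentialKernelDeriv hε hg hM hx), rotPotential]
  refine integral_congr_ae (Eventually.of_forall fun η => ?_)
  simp [potentialKernelDeriv_apply_skew ε hA, mul_comm]

/-- The potential is constant along rays, so rotational derivatives determine its whole gradient.
This is the form that `contDiffAt_and_laplacian_of_rotational` takes as input. -/
lemma potentialDeriv_apply {ε : ℝ} (hε : 0 ≤ ε) {g : UnitSphere → ℝ} (hg : Measurable g) {M : ℝ}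
    (hM : ∀ η, |g η| ≤ M) {x : E3} (hx : x ≠ 0) (v : E3) :
    potentialDeriv ε g x v =
      (‖x‖ ^ 2)⁻¹ * ∑ i, ⟪rotGen i x, v⟫ * rotPotential ε (rotGen i) g x := by
  rw [potentialDeriv, ContinuousLinearMap.integral_apply
    (integrable_potentialKernelDeriv hε hg hM hx)]
  simp only [rotPotential]
  simp only [← integral_const_mul]
  rw [← integral_finsetSum _ fun i _ =>
    (integrable_rotPotential hε (isSkewMap_rotGen i) hg hM hx).const_mul _, ← integral_const_mul]
  refine integral_congr_ae (Eventually.of_forall fun η => ?_)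
  simp only [smul_apply, potentialKernelDeriv_apply ε hx, smul_eq_mul,
    Finset.mul_sum]
  refine Finset.sum_congr rfl fun i _ => ?_
  ring

lemma hasFDerivAt_inner_nrm {x : E3} (hx : x ≠ 0) (η : UnitSphere) :
    HasFDerivAt (fun x => ⟪nrm x, (η : E3)⟫) (innerSL ℝ (nrmDeriv x η)) x := by
  have h2 := (innerSL ℝ (η : E3)).hasFDerivAt.comp x (hasFDerivAt_nrm hx)
  have h3 : (innerSL ℝ (η : E3) ∘ nrm) = fun x => ⟪nrm x, (η : E3)⟫ := by
    ext y; simp [real_inner_comm]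
  rw [h3] at h2
  refine h2.congr_fderiv ?_
  ext v
  simp [inner_nrmDeriv_comm]

lemma hasFDerivAt_greenKernel_nrm {ε : ℝ} {x : E3} (hx : x ≠ 0) (η : UnitSphere)
    (h : ⟪nrm x, (η : E3)⟫ < 1 + ε) :
    HasFDerivAt (fun x => greenKernel ε ⟪nrm x, (η : E3)⟫) (potentialKernelDeriv ε x η) x := by
  have h1 := hasFDerivAt_inner_nrm hx η
  exact (hasDerivAt_greenKernel h).comp_hasFDerivAt x h1

/-- For `ε > 0` the kernel has no singularity on `[-1, 1]`. Removing a ball about the origin keeps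
the factor `‖x‖⁻¹` in the gradient bounded. -/
lemma hasFDerivAt_potential_of_pos {ε : ℝ} (hε : 0 < ε) {g : UnitSphere → ℝ}
    (hg : Measurable g) {M : ℝ} (hM : ∀ η, |g η| ≤ M) {r : ℝ} (hr : 0 < r) :
    (∀ x ∈ (closedBall (0 : E3) r)ᶜ, HasFDerivAt (potential ε g) (potentialDeriv ε g x) x) ∧
      ContinuousOn (potentialDeriv ε g) (closedBall (0 : E3) r)ᶜ := by
  have hne : ∀ x ∈ (closedBall (0 : E3) r)ᶜ, x ≠ 0 := by
    rintro x hx rfl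
    simp [hr.le] at hx
  have hlt : ∀ x ∈ (closedBall (0 : E3) r)ᶜ, ∀ η : UnitSphere,
      ⟪nrm x, (η : E3)⟫ ∈ Set.Icc (-1 : ℝ) 1 := by
    intro x hx η
    obtain ⟨ξ, hξ⟩ := exists_coe_eq_nrm (hne x hx)
    exact hξ ▸ inner_unitSphere_mem ξ η
  have hk : ContinuousOn (greenKernel ε) (Set.Icc (-1) 1) := fun t ht =>
    (hasDerivAt_greenKernel (by linarith [ht.2])).continuousAt.continuousWithinAt
  have hk' : ∀ t ∈ Set.Icc (-1 : ℝ) 1, ContinuousAt (greenKernelDeriv ε) t := fun t ht =>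
    (hasDerivAt_greenKernelDeriv (by linarith [ht.2])).continuousAt
  obtain ⟨C₁, hC₁⟩ := isCompact_Icc.exists_bound_of_continuousOn hk
  obtain ⟨C₂, hC₂⟩ := isCompact_Icc.exists_bound_of_continuousOn
    (fun t ht => (hk' t ht).continuousWithinAt)
  have hC₂0 : 0 ≤ C₂ := (norm_nonneg _).trans (hC₂ 0 (by norm_num))
  refine hasFDerivAt_integral_kernel (K := fun x η => greenKernel ε ⟪nrm x, (η : E3)⟫)
    (K' := potentialKernelDeriv ε) (C := max C₁ (C₂ * (r⁻¹ * 2))) isClosed_closedBall.isOpen_compl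
    (fun x _ => ((measurable_greenKernel ε).comp (by fun_prop)).aestronglyMeasurable)
    (fun x _ => (measurable_potentialKernelDeriv ε x).aestronglyMeasurable)
    (integrable_of_bounded hg hM)
    (fun x hx η _ => (hC₁ _ (hlt x hx η)).trans (le_max_left _ _))
    (fun x hx η _ => le_trans ?_ (le_max_right _ _))
    (fun η _ x hx => hasFDerivAt_greenKernel_nrm (hne x hx) η (by linarith [(hlt x hx η).2]))
    (fun η _ x hx => ContinuousAt.continuousWithinAt ?_)
  · rw [potentialKernelDeriv, norm_smul, innerSL_apply_norm]
    refine mul_le_mul (hC₂ _ (hlt x hx η)) ?_ (norm_nonneg _) hC₂0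
    have h1 := norm_nrmDeriv_sq (hne x hx) η
    have h2 : ‖x‖ * ‖nrmDeriv x η‖ ≤ 2 := by
      refine le_of_sq_le_sq ?_ (by norm_num)
      linarith [(hlt x hx η).1]
    have h3 : r < ‖x‖ := by simpa using hx
    rw [le_inv_mul_iff₀ hr]
    nlinarith [norm_nonneg (nrmDeriv x (η : E3))]
  · unfold potentialKernelDeriv
    have h1 := (contDiffAt_nrm (hne x hx) (k := 0)).continuousAt
    have h2 : ContinuousAt (fun x => ⟪nrm x, (η : E3)⟫) x := h1.inner continuousAt_const
    have h3 : ContinuousAt (fun x => greenKernelDeriv ε ⟪nrm x, (η : E3)⟫) x :=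
      ContinuousAt.comp (f := fun x => ⟪nrm x, (η : E3)⟫) (hk' _ (hlt x hx η)) h2
    refine h3.smul ((innerSL ℝ).continuous.continuousAt.comp
      ((continuousAt_nrmDeriv (hne x hx)).clm_apply continuousAt_const))

lemma norm_potentialDeriv_sub_le {g : UnitSphere → ℝ} (hg : Measurable g) {M : ℝ}
    (hM : ∀ η, |g η| ≤ M) {s : ℝ} (hs : 0 < s) {x : E3} (hx : x ≠ 0) :
    ‖potentialDeriv (s ^ 4) g x - potentialDeriv 0 g x‖ ≤
      s * (M * (‖x‖⁻¹ * (12 * (4 * Real.pi)))) := by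
  obtain ⟨ξ, hξ⟩ := exists_coe_eq_nrm hx
  have hx' : 0 < ‖x‖ := norm_pos_iff.2 hx
  obtain ⟨hw, hwle⟩ := integrable_singularWeight_and_le ξ
  simp only [hξ] at hw hwle
  have hM0 : 0 ≤ M := (abs_nonneg _).trans (hM ξ)
  rw [potentialDeriv, potentialDeriv, ← integral_sub
    (integrable_potentialKernelDeriv (by positivity) hg hM hx)
    (integrable_potentialKernelDeriv le_rfl hg hM hx)]
  refine (norm_integral_le_of_norm_le (hw.const_mul (s * (M * ‖x‖⁻¹)))
    (Eventually.of_forall fun η => ?_)).trans ?_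
  · have ht := inner_unitSphere_mem ξ η
    rw [hξ] at ht
    have h := abs_greenKernelDeriv_sub_mul_le ht.2 hs (by positivity) (norm_nrmDeriv_sq hx η)
    have e : g η • potentialKernelDeriv (s ^ 4) x η - g η • potentialKernelDeriv 0 x η =
        g η • (greenKernelDeriv (s ^ 4) ⟪nrm x, (η : E3)⟫ -
          greenKernelDeriv 0 ⟪nrm x, (η : E3)⟫) • innerSL ℝ (nrmDeriv x η) := by
      ext v
      simp [potentialKernelDeriv]
      ring
    rw [e, norm_smul, norm_smul,
      innerSL_apply_norm, Real.norm_eq_abs, Real.norm_eq_abs]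
    calc _ ≤ M * (‖x‖⁻¹ * (s * singularWeight ⟪nrm x, (η : E3)⟫)) := by
          refine mul_le_mul (hM η) ?_ (by positivity) hM0
          rw [le_inv_mul_iff₀ hx']
          linarith
      _ = _ := by ring
  · rw [integral_const_mul]
    calc _ ≤ s * (M * ‖x‖⁻¹) * (12 * (4 * Real.pi)) := by gcongr
      _ = _ := by ring

lemma tendsto_potential {g : UnitSphere → ℝ} (hg : Measurable g) {M : ℝ}
    (hM : ∀ η, |g η| ≤ M) {x : E3} (hx : x ≠ 0) {ε : ℕ → ℝ} (hε : ∀ n, 0 ≤ ε n)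
    (hε1 : ∀ n, ε n ≤ 1) (hε0 : Tendsto ε atTop (𝓝 0)) :
    Tendsto (fun n => potential (ε n) g x) atTop (𝓝 (potential 0 g x)) := by
  obtain ⟨ξ, hξ⟩ := exists_coe_eq_nrm hx
  simp only [potential, ← hξ]
  refine tendsto_integral_of_dominated_convergence
    (fun η => (1 + singularWeight ⟪(ξ : E3), (η : E3)⟫) * M)
    (fun n => (integrable_greenKernel_mul (hε n) (hε1 n) hg hM ξ).aestronglyMeasurable)
    (((integrable_const (1 : ℝ)).add (integrable_singularWeight_and_le ξ).1).mul_const M) ?_ ?_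
  · intro n
    filter_upwards [ae_inner_lt_one ξ] with η hη
    have h := abs_greenKernel_le ⟨(inner_unitSphere_mem ξ η).1, hη⟩ (hε n) (hε1 n)
    rw [norm_mul]
    exact mul_le_mul h (hM η) (abs_nonneg _) ((abs_nonneg _).trans h)
  · filter_upwards [ae_inner_lt_one ξ] with η hη
    refine Tendsto.mul_const (g η) ?_
    unfold greenKernel
    have h1 : Tendsto (fun n => 1 + ε n - ⟪(ξ : E3), (η : E3)⟫) atTop
        (𝓝 (1 + 0 - ⟪(ξ : E3), (η : E3)⟫)) := (hε0.const_add 1).sub_const _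
    exact ((h1.log (by linarith)).const_mul (1 / (4 * Real.pi))).add_const
      (1 / (4 * Real.pi) * (1 - Real.log 2))

lemma tendsto_one_div_add_pow_four :
    Tendsto (fun n : ℕ => (1 / ((n : ℝ) + 1)) ^ 4) atTop (𝓝 0) := by
  simpa using (tendsto_one_div_add_atTop_nhds_zero_nat (𝕜 := ℝ)).pow 4

lemma one_div_add_pow_four_mem (n : ℕ) :
    0 < (1 / ((n : ℝ) + 1)) ^ 4 ∧ (1 / ((n : ℝ) + 1)) ^ 4 ≤ 1 := by
  refine ⟨by positivity, pow_le_one₀ (by positivity) ?_⟩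
  rw [div_le_one (by positivity)]
  linarith [(Nat.cast_nonneg n : (0 : ℝ) ≤ n)]

/-- The potential of a bounded measurable density is of class `C¹`. -/
lemma hasFDerivAt_potential {g : UnitSphere → ℝ} (hg : Measurable g) {M : ℝ}
    (hM : ∀ η, |g η| ≤ M) {x : E3} (hx : x ≠ 0) :
    HasFDerivAt (potential 0 g) (potentialDeriv 0 g x) x ∧
      ContinuousAt (potentialDeriv 0 g) x := by
  have hx' : 0 < ‖x‖ := norm_pos_iff.2 hx
  set B : Set E3 := (closedBall (0 : E3) (‖x‖ / 2))ᶜ with hB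
  have hBo : IsOpen B := isClosed_closedBall.isOpen_compl
  have hxB : x ∈ B := by simpa [hB] using half_lt_self hx'
  have hM0 : 0 ≤ M := by
    obtain ⟨ξ, -⟩ := exists_coe_eq_nrm hx
    exact (abs_nonneg _).trans (hM ξ)
  have hBn : ∀ y ∈ B, ‖x‖ / 2 < ‖y‖ := fun y hy => by simpa [hB] using hy
  have hBne : ∀ y ∈ B, y ≠ 0 := fun y hy => norm_pos_iff.1 (by linarith [hBn y hy])
  -- Fourth powers serve as regularization parameters, so the error is of order `1 / (n + 1)`. It is
  -- uniform on `B` because the weight's integral is bounded independently of the pole.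
  have hu : TendstoUniformlyOn (fun (n : ℕ) => potentialDeriv ((1 / ((n : ℝ) + 1)) ^ 4) g)
      (potentialDeriv 0 g) atTop B := by
    rw [Metric.tendstoUniformlyOn_iff]
    intro δ hδ
    have h0 : Tendsto (fun n : ℕ => 1 / ((n : ℝ) + 1) *
        (M * ((‖x‖ / 2)⁻¹ * (12 * (4 * Real.pi))))) atTop (𝓝 0) := by
      simpa using (tendsto_one_div_add_atTop_nhds_zero_nat (𝕜 := ℝ)).mul_const
        (M * ((‖x‖ / 2)⁻¹ * (12 * (4 * Real.pi))))
    filter_upwards [h0.eventually_lt_const hδ] with n hn y hy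
    rw [dist_comm, dist_eq_norm]
    refine (norm_potentialDeriv_sub_le hg hM (by positivity) (hBne y hy)).trans_lt
      (lt_of_le_of_lt ?_ hn)
    have := inv_anti₀ (by positivity) (hBn y hy).le
    gcongr
  have hn := fun n : ℕ => hasFDerivAt_potential_of_pos (one_div_add_pow_four_mem n).1 hg hM
    (half_pos hx')
  constructor
  · exact hasFDerivAt_of_tendstoUniformlyOn hBo hu (fun n => (hn n).1)
      (fun y hy => tendsto_potential hg hM (hBne y hy) (fun n => (one_div_add_pow_four_mem n).1.le)
        (fun n => (one_div_add_pow_four_mem n).2) tendsto_one_div_add_pow_four) hxB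
  · exact (hu.continuousOn (Frequently.of_forall fun n => (hn n).2)).continuousAt
      (hBo.mem_nhds hxB)

end Potential

/-! ### Smooth densities: commuting with rotations and the approximate identity -/

section NearPart

lemma continuous_comp_coe {f : E3 → ℝ} (hf : ∀ η : UnitSphere, ContDiffAt ℝ 1 f η) :
    Continuous fun η : UnitSphere => f η :=
  continuous_iff_continuousAt.2 fun η =>
    ContinuousAt.comp (f := fun η : UnitSphere => (η : E3)) (hf η).continuousAt
      continuous_subtype_val.continuousAt

lemma exists_abs_le_of_continuous {g : UnitSphere → ℝ} (hg : Continuous g) :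
    ∃ M, ∀ η, |g η| ≤ M := by
  obtain ⟨M, hM⟩ := isCompact_univ.exists_bound_of_continuousOn hg.continuousOn
  exact ⟨M, fun η => hM η (Set.mem_univ _)⟩

lemma continuous_fderiv_skew {f : E3 → ℝ} (hf : ∀ η : UnitSphere, ContDiffAt ℝ 1 f η)
    (A : E3 →L[ℝ] E3) : Continuous fun η : UnitSphere => fderiv ℝ f η (A η) :=
  (exists_bound_fderiv hf).1.clm_apply (by fun_prop)

/-- Infinitesimal rotations commute with the potential. -/
lemma rotPotential_eq_potential {A : E3 →L[ℝ] E3} (hA : IsSkewMap A) {f : E3 → ℝ}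
    (hf : ∀ η : UnitSphere, ContDiffAt ℝ 1 f η) {x : E3} (hx : x ≠ 0) :
    rotPotential 0 A (fun η => f η) x = potential 0 (fun η => fderiv ℝ f η (A η)) x := by
  obtain ⟨ξ, hξ⟩ := exists_coe_eq_nrm hx
  obtain ⟨M, hM⟩ := exists_abs_le_of_continuous (continuous_comp_coe hf)
  have hm := (continuous_comp_coe hf).measurable
  have hξ0 : (ξ : E3) ≠ 0 := ne_zero_of_mem_unit_sphere ξ
  suffices h : rotPotential 0 A (fun η => f η) ξ = potential 0 (fun η => fderiv ℝ f η (A η)) ξ by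
    unfold rotPotential potential at h ⊢
    rwa [nrm_coe, hξ] at h
  rw [← potentialDeriv_apply_skew le_rfl hA hm hM hξ0]
  have h1 := (hasFDerivAt_potential hm hM hξ0).1
  rw [← hA.rotation_zero (ξ : E3)] at h1
  have h2 := h1.comp_hasDerivAt (0 : ℝ) (hA.hasDerivAt_rotation (ξ : E3) 0)
  rw [hA.rotation_zero] at h2
  have h3 := hasDerivAt_integral_rotation hA hf (integrable_greenKernel le_rfl zero_le_one ξ)
  -- Rotating the point amounts to rotating the density, as the kernel depends only on the inner
  -- product. Differentiating both forms at angle zero and comparing gives the claim.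
  have h4 : (potential 0 fun η : UnitSphere => f η) ∘ (fun s => hA.rotation s ξ) =
      fun s => ∫ η : UnitSphere, greenKernel 0 ⟪(ξ : E3), (η : E3)⟫ * f (hA.rotation s η)
        ∂surfaceMeasure := by
    ext s
    have h5 : nrm (hA.rotation s ξ) = hA.rotation s ξ := nrm_coe (sphereHomeomorph _ ξ)
    rw [Function.comp_apply, potential, h5, ← integral_comp_sphereHomeomorph (hA.rotation s)]
    simp only [coe_sphereHomeomorph, LinearIsometryEquiv.inner_map_map]
  rw [h4] at h2
  rw [h2.unique h3, potential, nrm_coe]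

lemma tendsto_rotPotential {A : E3 →L[ℝ] E3} (hA : IsSkewMap A) {g : UnitSphere → ℝ}
    (hg : Measurable g) {M : ℝ} (hM : ∀ η, |g η| ≤ M) {x : E3} (hx : x ≠ 0) :
    Tendsto (fun n : ℕ => rotPotential ((1 / ((n : ℝ) + 1)) ^ 4) A g x) atTop
      (𝓝 (rotPotential 0 A g x)) := by
  have h : Tendsto (fun n : ℕ => potentialDeriv ((1 / ((n : ℝ) + 1)) ^ 4) g x) atTop
      (𝓝 (potentialDeriv 0 g x)) := by
    rw [tendsto_iff_norm_sub_tendsto_zero]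
    refine squeeze_zero (fun _ => norm_nonneg _)
      (fun n => norm_potentialDeriv_sub_le hg hM (by positivity) hx) ?_
    simpa using (tendsto_one_div_add_atTop_nhds_zero_nat (𝕜 := ℝ)).mul_const
      (M * (‖x‖⁻¹ * (12 * (4 * Real.pi))))
  have h2 := ((ContinuousLinearMap.apply ℝ ℝ (A x)).continuous.tendsto _).comp h
  simp only [← potentialDeriv_apply_skew le_rfl hA hg hM hx,
    ← potentialDeriv_apply_skew (one_div_add_pow_four_mem _).1.le hA hg hM hx]
  exact h2

/-- The approximate identity obtained by applying the Beltrami operator to the regularized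
kernel. -/
noncomputable def peakKernel (ε t : ℝ) : ℝ :=
  1 / (4 * Real.pi) * ((2 * ε + ε ^ 2) * ((1 + ε - t) ^ 2)⁻¹)

/-- With `s = 1 + ε - t`, adding `1 / (4π)` to the left side completes the square `(t + s) ^ 2 = (1
+ ε) ^ 2`. At `ε = 0` the peak vanishes, which is the equation for `G` off its pole. -/
lemma beltrami_greenKernel_eq {ε t : ℝ} (h : t < 1 + ε) :
    greenKernelDeriv2 ε t * (1 - t ^ 2) - 2 * t * greenKernelDeriv ε t =
      peakKernel ε t - 1 / (4 * Real.pi) := by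
  have h1 : 1 + ε - t ≠ 0 := by linarith
  rw [greenKernelDeriv, greenKernelDeriv2, peakKernel]
  field_simp
  ring

lemma sum_rotPotential_regularized {ε : ℝ} (hε : 0 < ε) {f : E3 → ℝ}
    (hf : ∀ η : UnitSphere, ContDiffAt ℝ 1 f η) (ξ : UnitSphere) :
    ∑ i, rotPotential ε (rotGen i) (fun η => fderiv ℝ f η (rotGen i η)) ξ =
      ∫ η : UnitSphere, (peakKernel ε ⟪(ξ : E3), (η : E3)⟫ - 1 / (4 * Real.pi)) * f η
        ∂surfaceMeasure := by
  have hd : ∀ t ∈ Set.Icc (-1 : ℝ) 1, ContDiffAt ℝ 1 (greenKernelDeriv ε) t := fun t ht => by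
    unfold greenKernelDeriv
    exact contDiffAt_const.mul ((contDiffAt_const.sub contDiffAt_id).inv
      (by rw [id]; linarith [ht.2]))
  have h := integral_zonal_green hd
    (fun t ht => hasDerivAt_greenKernelDeriv (by linarith [ht.2])) hf ξ
  simp only [rotPotential, nrm_coe]
  rw [← h]
  refine integral_congr_ae (Eventually.of_forall fun η => ?_)
  simp only
  rw [beltrami_greenKernel_eq (by linarith [(inner_unitSphere_mem ξ η).2])]

lemma continuous_peakKernel {ε : ℝ} (hε : 0 < ε) (ξ : UnitSphere) :
    Continuous fun η : UnitSphere => peakKernel ε ⟪(ξ : E3), (η : E3)⟫ := by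
  unfold peakKernel
  refine continuous_const.mul (continuous_const.mul (Continuous.inv₀ (by fun_prop) fun η => ?_))
  have := (inner_unitSphere_mem ξ η).2
  exact (pow_pos (by linarith) 2).ne'

/-- Taking `f = 1` in the regularized identity kills every derivative, so the mass is `4π / (4π)`.
-/
lemma integral_peakKernel {ε : ℝ} (hε : 0 < ε) (ξ : UnitSphere) :
    ∫ η : UnitSphere, peakKernel ε ⟪(ξ : E3), (η : E3)⟫ ∂surfaceMeasure = 1 := by
  have h := sum_rotPotential_regularized hε (f := fun _ => 1) (fun _ => contDiffAt_const) ξ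
  simp only [rotPotential, fderiv_fun_const, Pi.zero_apply, zero_apply, mul_zero,
    integral_zero, Finset.sum_const_zero, mul_one] at h
  rw [integral_sub (integrable_of_continuous_unitSphere (continuous_peakKernel hε ξ))
    (integrable_const _), integral_const, surfaceMeasure_univ, smul_eq_mul,
    mul_one_div_cancel (by positivity)] at h
  linarith

lemma tendsto_integral_peakKernel {f : UnitSphere → ℝ} (hf : Continuous f) (ξ : UnitSphere) :
    Tendsto (fun n : ℕ => ∫ η : UnitSphere,
      peakKernel ((1 / ((n : ℝ) + 1)) ^ 4) ⟪(ξ : E3), (η : E3)⟫ * f η ∂surfaceMeasure) atTop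
      (𝓝 (f ξ)) := by
  have hpos := fun n => (one_div_add_pow_four_mem n).1
  have h := tendsto_setIntegral_peak_smul_of_integrableOn_of_tendsto (μ := surfaceMeasure)
    (s := Set.univ) (t := Set.univ) (x₀ := ξ) (l := atTop) (g := f) (a := f ξ)
    (φ := fun (n : ℕ) (η : UnitSphere) =>
      peakKernel ((1 / ((n : ℝ) + 1)) ^ 4) ⟪(ξ : E3), (η : E3)⟫)
    MeasurableSet.univ MeasurableSet.univ subset_rfl univ_mem (measure_ne_top _ _)
    (Eventually.of_forall fun n η _ => by unfold peakKernel; have := hpos n; positivity)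
    ?_ ?_
    (Eventually.of_forall fun n => (continuous_peakKernel (hpos n) ξ).aestronglyMeasurable)
    (integrable_of_continuous_unitSphere hf).integrableOn (by
      rw [nhdsWithin_univ]; exact hf.continuousAt)
  · simpa using h
  · intro u hu hξu
    rcases (Set.univ \ u).eq_empty_or_nonempty with he | hne
    · rw [he]; exact tendstoUniformlyOn_empty
    have hcomp : IsCompact (Set.univ \ u) := (isClosed_univ.sdiff hu).isCompact
    -- On the compact complement of `u` the inner product with `ξ` stays at least `δ` below 1, so
    -- there the peak is `O(ε)` uniformly.
    obtain ⟨η₀, hη₀, hmax⟩ := hcomp.exists_isMaxOn hne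
      (f := fun η : UnitSphere => ⟪(ξ : E3), (η : E3)⟫) (by fun_prop)
    have hlt : ⟪(ξ : E3), (η₀ : E3)⟫ < 1 := by
      refine lt_of_le_of_ne (inner_unitSphere_mem ξ η₀).2 fun h => hη₀.2 ?_
      rwa [← (inner_unitSphere_eq_one_iff ξ η₀).1 h]
    set δ := 1 - ⟪(ξ : E3), (η₀ : E3)⟫ with hδ
    have hδ0 : 0 < δ := by linarith
    rw [Metric.tendstoUniformlyOn_iff]
    intro c hc
    have hlim : Tendsto (fun n : ℕ => 1 / (4 * Real.pi) * ((2 * (1 / ((n : ℝ) + 1)) ^ 4 +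
        ((1 / ((n : ℝ) + 1)) ^ 4) ^ 2) * (δ ^ 2)⁻¹)) atTop (𝓝 0) := by
      have h1 := tendsto_one_div_add_pow_four
      simpa using (((h1.const_mul 2).add (h1.pow 2)).mul_const (δ ^ 2)⁻¹).const_mul
        (1 / (4 * Real.pi))
    filter_upwards [hlim.eventually_lt_const hc] with n hn η hη
    have h1 : ⟪(ξ : E3), (η : E3)⟫ ≤ ⟪(ξ : E3), (η₀ : E3)⟫ := hmax hη
    have h2 := hpos n
    rw [Pi.zero_apply, dist_zero_left, Real.norm_of_nonneg (by unfold peakKernel; positivity)]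
    refine lt_of_le_of_lt ?_ hn
    unfold peakKernel
    have h3 : ((1 + (1 / ((n : ℝ) + 1)) ^ 4 - ⟪(ξ : E3), (η : E3)⟫) ^ 2)⁻¹ ≤ (δ ^ 2)⁻¹ :=
      inv_anti₀ (by positivity) (pow_le_pow_left₀ hδ0.le (by linarith) 2)
    gcongr
  · simp only [Measure.restrict_univ, integral_peakKernel (hpos _) ξ]
    exact tendsto_const_nhds

lemma sum_rotPotential_fderiv {f : E3 → ℝ} (hf : ∀ η : UnitSphere, ContDiffAt ℝ 1 f η)
    (ξ : UnitSphere) :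
    ∑ i, rotPotential 0 (rotGen i) (fun η => fderiv ℝ f η (rotGen i η)) ξ =
      f ξ - 1 / (4 * Real.pi) * ∫ η : UnitSphere, f η ∂surfaceMeasure := by
  have hξ0 : (ξ : E3) ≠ 0 := ne_zero_of_mem_unit_sphere ξ
  have h1 : Tendsto (fun n : ℕ => ∑ i, rotPotential ((1 / ((n : ℝ) + 1)) ^ 4) (rotGen i)
      (fun η => fderiv ℝ f η (rotGen i η)) ξ) atTop
      (𝓝 (∑ i, rotPotential 0 (rotGen i) (fun η => fderiv ℝ f η (rotGen i η)) ξ)) := by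
    refine tendsto_finsetSum _ fun i _ => ?_
    have hc := continuous_fderiv_skew hf (rotGen i)
    obtain ⟨M, hM⟩ := exists_abs_le_of_continuous hc
    exact tendsto_rotPotential (isSkewMap_rotGen i) hc.measurable hM hξ0
  have hfc := continuous_comp_coe hf
  have h2 := (tendsto_integral_peakKernel hfc ξ).sub_const
    (1 / (4 * Real.pi) * ∫ η : UnitSphere, f η ∂surfaceMeasure)
  refine tendsto_nhds_unique h1 (h2.congr fun n => ?_)
  have hpos := (one_div_add_pow_four_mem n).1
  rw [sum_rotPotential_regularized hpos hf ξ, ← integral_const_mul, ← integral_sub]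
  · refine integral_congr_ae (Eventually.of_forall fun η => ?_)
    simp only
    ring
  · exact integrable_of_continuous_unitSphere ((continuous_peakKernel hpos ξ).mul hfc)
  · exact integrable_of_continuous_unitSphere (continuous_const.mul hfc)

end NearPart

/-! ### Densities vanishing near the point -/

section FarPart

/-- The Fréchet derivative of the kernel of `rotPotential 0 A`. -/
noncomputable def rotKernelDeriv (A : E3 →L[ℝ] E3) (x : E3) (η : UnitSphere) : E3 →L[ℝ] ℝ :=
  (greenKernelDeriv2 0 ⟪nrm x, (η : E3)⟫ * ⟪A (nrm x), (η : E3)⟫) • innerSL ℝ (nrmDeriv x η) +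
    greenKernelDeriv 0 ⟪nrm x, (η : E3)⟫ • (innerSL ℝ (η : E3)).comp (A.comp (nrmDeriv x))

lemma measurable_rotKernelDeriv (A : E3 →L[ℝ] E3) (x : E3) : Measurable (rotKernelDeriv A x) := by
  unfold rotKernelDeriv
  refine Measurable.add (Measurable.smul (Measurable.mul
    ((measurable_greenKernelDeriv2 0).comp (by fun_prop)) ?_) ?_)
    (Measurable.smul ((measurable_greenKernelDeriv 0).comp (by fun_prop)) ?_)
  · exact Continuous.measurable (by fun_prop)
  · exact Continuous.measurable (by fun_prop)
  · exact Continuous.measurable (by fun_prop)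

lemma hasFDerivAt_rotKernel (A : E3 →L[ℝ] E3) {x : E3} (hx : x ≠ 0) (η : UnitSphere)
    (h : ⟪nrm x, (η : E3)⟫ < 1) :
    HasFDerivAt (fun x => greenKernelDeriv 0 ⟪nrm x, (η : E3)⟫ * ⟪A (nrm x), (η : E3)⟫)
      (rotKernelDeriv A x η) x := by
  have h1 := (hasDerivAt_greenKernelDeriv (ε := 0) (by linarith)).comp_hasFDerivAt x
    (hasFDerivAt_inner_nrm hx η)
  have h2 := ((innerSL ℝ (η : E3)).comp A).hasFDerivAt.comp x (hasFDerivAt_nrm hx)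
  have h3 : (((innerSL ℝ (η : E3)).comp A) ∘ nrm) = fun x => ⟪A (nrm x), (η : E3)⟫ := by
    ext y; simp [real_inner_comm]
  rw [h3] at h2
  refine (h1.mul h2).congr_fderiv ?_
  ext v
  simp [rotKernelDeriv]
  ring

lemma hasFDerivAt_rotPotential_of_far {A : E3 →L[ℝ] E3} {g : UnitSphere → ℝ} (hg : Measurable g)
    {M : ℝ} (hM : ∀ η, |g η| ≤ M) (ξ : UnitSphere) {ρ : ℝ} (hρ : 0 < ρ)
    (hsupp : ∀ η, g η ≠ 0 → ρ ≤ dist (η : E3) ξ) :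
    ∃ B : Set E3, IsOpen B ∧ (ξ : E3) ∈ B ∧
      (∀ x ∈ B, HasFDerivAt (rotPotential 0 A g) (∫ η, g η • rotKernelDeriv A x η ∂surfaceMeasure) x)
      ∧ ContinuousOn (fun x => ∫ η, g η • rotKernelDeriv A x η ∂surfaceMeasure) B ∧
      Integrable (fun η => g η • rotKernelDeriv A ξ η) surfaceMeasure := by
  have hξ0 : (ξ : E3) ≠ 0 := ne_zero_of_mem_unit_sphere ξ
  -- For `x` this close to `ξ`, the projection of `x` misses the set `S` containing the support of
  -- `g`. Compactness of a closed ball times `S` then bounds the kernel and its derivative.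
  have hev : ∀ᶠ x in 𝓝 (ξ : E3), x ≠ 0 ∧ dist (nrm x) ξ < ρ := by
    refine (isOpen_ne.eventually_mem hξ0).and ?_
    have h := (contDiffAt_nrm hξ0 (k := 0)).continuousAt
    have h2 : Tendsto (fun x => dist (nrm x) (ξ : E3)) (𝓝 (ξ : E3)) (𝓝 0) := by
      have := h.tendsto.dist (tendsto_const_nhds (x := (ξ : E3)))
      rwa [nrm_coe, dist_self] at this
    exact h2.eventually_lt_const hρ
  obtain ⟨r, hr, hball⟩ := Metric.eventually_nhds_iff_ball.1 hev
  have hball' : ∀ x ∈ closedBall (ξ : E3) (r / 2), x ≠ 0 ∧ dist (nrm x) ξ < ρ := fun x hx =>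
    hball x (closedBall_subset_ball (by linarith) hx)
  let S : Set UnitSphere := {η | ρ ≤ dist (η : E3) ξ}
  have hS : IsCompact S := (isClosed_le continuous_const (by fun_prop)).isCompact
  have hlt : ∀ x ∈ closedBall (ξ : E3) (r / 2), ∀ η ∈ S, ⟪nrm x, (η : E3)⟫ < 1 := by
    intro x hx η hη
    obtain ⟨h0, h1⟩ := hball' x hx
    obtain ⟨ζ, hζ⟩ := exists_coe_eq_nrm h0
    rw [← hζ] at h1 ⊢
    refine lt_of_le_of_ne (inner_unitSphere_mem ζ η).2 fun h => ?_
    rw [(inner_unitSphere_eq_one_iff ζ η).1 h] at h1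
    exact absurd hη (not_le.2 h1)
  have hnrm : ContinuousOn (fun p : E3 × UnitSphere => nrm p.1)
      (closedBall (ξ : E3) (r / 2) ×ˢ S) := fun p hp =>
    (ContinuousAt.comp (f := Prod.fst) (contDiffAt_nrm (hball' p.1 hp.1).1 (k := 0)).continuousAt
      continuous_fst.continuousAt).continuousWithinAt
  have hnrmD : ContinuousOn (fun p : E3 × UnitSphere => nrmDeriv p.1)
      (closedBall (ξ : E3) (r / 2) ×ˢ S) := fun p hp =>
    (ContinuousAt.comp (f := Prod.fst) (continuousAt_nrmDeriv (hball' p.1 hp.1).1)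
      continuous_fst.continuousAt).continuousWithinAt
  have hη : ContinuousOn (fun p : E3 × UnitSphere => (p.2 : E3))
      (closedBall (ξ : E3) (r / 2) ×ˢ S) := by fun_prop
  have hin : ContinuousOn (fun p : E3 × UnitSphere => ⟪nrm p.1, (p.2 : E3)⟫)
      (closedBall (ξ : E3) (r / 2) ×ˢ S) := hnrm.inner hη
  have hne : ∀ p ∈ closedBall (ξ : E3) (r / 2) ×ˢ S, 1 + 0 - ⟪nrm p.1, (p.2 : E3)⟫ ≠ 0 :=
    fun p hp => by linarith [hlt p.1 hp.1 p.2 hp.2]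
  have hk1 : ContinuousOn (fun p : E3 × UnitSphere => greenKernelDeriv 0 ⟪nrm p.1, (p.2 : E3)⟫)
      (closedBall (ξ : E3) (r / 2) ×ˢ S) :=
    continuousOn_const.mul ((continuousOn_const.sub hin).inv₀ hne)
  have hk2 : ContinuousOn (fun p : E3 × UnitSphere => greenKernelDeriv2 0 ⟪nrm p.1, (p.2 : E3)⟫)
      (closedBall (ξ : E3) (r / 2) ×ˢ S) :=
    continuousOn_const.mul (((continuousOn_const.sub hin).pow 2).inv₀
      fun p hp => pow_ne_zero 2 (hne p hp))
  have hA : ContinuousOn (fun p : E3 × UnitSphere => ⟪A (nrm p.1), (p.2 : E3)⟫)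
      (closedBall (ξ : E3) (r / 2) ×ˢ S) := (A.continuous.comp_continuousOn hnrm).inner hη
  have hK : ContinuousOn (fun p : E3 × UnitSphere => greenKernelDeriv 0 ⟪nrm p.1, (p.2 : E3)⟫ *
      ⟪A (nrm p.1), (p.2 : E3)⟫) (closedBall (ξ : E3) (r / 2) ×ˢ S) := hk1.mul hA
  have hK' : ContinuousOn (fun p : E3 × UnitSphere => rotKernelDeriv A p.1 p.2)
      (closedBall (ξ : E3) (r / 2) ×ˢ S) := by
    unfold rotKernelDeriv
    refine ((hk2.mul hA).smul ?_).add (hk1.smul ?_)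
    · exact (innerSL ℝ).continuous.comp_continuousOn (hnrmD.clm_apply hη)
    · exact ((innerSL ℝ).continuous.comp_continuousOn hη).clm_comp
        (continuousOn_const.clm_comp hnrmD)
  have hcpt : IsCompact (closedBall (ξ : E3) (r / 2) ×ˢ S) := (isCompact_closedBall _ _).prod hS
  obtain ⟨C₁, hC₁⟩ := hcpt.exists_bound_of_continuousOn hK
  obtain ⟨C₂, hC₂⟩ := hcpt.exists_bound_of_continuousOn hK'
  have hsub : ball (ξ : E3) (r / 2) ⊆ closedBall (ξ : E3) (r / 2) := ball_subset_closedBall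
  have hξB : (ξ : E3) ∈ ball (ξ : E3) (r / 2) := mem_ball_self (by positivity)
  obtain ⟨h1, h2⟩ := hasFDerivAt_integral_kernel (B := ball (ξ : E3) (r / 2))
    (K := fun x η => greenKernelDeriv 0 ⟪nrm x, (η : E3)⟫ * ⟪A (nrm x), (η : E3)⟫)
    (K' := rotKernelDeriv A) (g := g) (C := max C₁ C₂) isOpen_ball
    (fun x _ => (((measurable_greenKernelDeriv 0).comp (by fun_prop)).mul
      (Continuous.measurable (by fun_prop))).aestronglyMeasurable)
    (fun x _ => (measurable_rotKernelDeriv A x).aestronglyMeasurable)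
    (integrable_of_bounded hg hM)
    (fun x hx η hgη => (hC₁ (x, η) ⟨hsub hx, hsupp η hgη⟩).trans (le_max_left _ _))
    (fun x hx η hgη => (hC₂ (x, η) ⟨hsub hx, hsupp η hgη⟩).trans (le_max_right _ _))
    (fun η hgη x hx => hasFDerivAt_rotKernel A (hball' x (hsub hx)).1 η
      (hlt x (hsub hx) η (hsupp η hgη)))
    (fun η hgη => hK'.comp (f := fun x : E3 => (x, η)) (by fun_prop)
      fun x hx => ⟨hsub hx, hsupp η hgη⟩)
  refine ⟨ball (ξ : E3) (r / 2), isOpen_ball, hξB, h1, h2, ?_⟩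
  refine ((integrable_of_bounded hg hM).norm.mul_const C₂).mono'
    (hg.smul (measurable_rotKernelDeriv A ξ)).aestronglyMeasurable
    (Eventually.of_forall fun η => ?_)
  rw [norm_smul]
  by_cases h : g η = 0
  · simp [h]
  · exact mul_le_mul_of_nonneg_left (hC₂ (ξ, η) ⟨hsub hξB, hsupp η h⟩) (norm_nonneg _)

lemma rotKernelDeriv_apply_skew {A : E3 →L[ℝ] E3} (hA : IsSkewMap A) (ξ η : UnitSphere) :
    rotKernelDeriv A ξ η (A ξ) = greenKernelDeriv2 0 ⟪(ξ : E3), (η : E3)⟫ *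
      ⟪A ξ, (η : E3)⟫ ^ 2 + greenKernelDeriv 0 ⟪(ξ : E3), (η : E3)⟫ * ⟪A (A ξ), (η : E3)⟫ := by
  have h1 : nrmDeriv ξ (A ξ) = A ξ := by rw [hA.nrmDeriv_apply, nrm_coe]
  have h2 : ⟪nrmDeriv (ξ : E3) η, A ξ⟫ = ⟪A ξ, (η : E3)⟫ := by
    rw [inner_nrmDeriv_comm, h1, real_inner_comm]
  simp only [rotKernelDeriv, add_apply, smul_apply, ContinuousLinearMap.comp_apply,
    innerSL_apply_apply, h1, h2, nrm_coe, smul_eq_mul]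
  rw [real_inner_comm (η : E3) (A (A ξ))]
  ring

lemma sum_rotKernelDeriv {ξ η : UnitSphere} (h : ξ ≠ η) :
    ∑ i, rotKernelDeriv (rotGen i) ξ η (rotGen i ξ) = -(1 / (4 * Real.pi)) := by
  have ht : ⟪(ξ : E3), (η : E3)⟫ < 1 :=
    lt_of_le_of_ne (inner_unitSphere_mem ξ η).2 fun h' => h ((inner_unitSphere_eq_one_iff ξ η).1 h')
  have h6 := sum_inner_rotGen_mul (ξ : E3) η η
  simp only [norm_coe_unitSphere, real_inner_self_eq_norm_sq, ← sq] at h6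
  simp only [rotKernelDeriv_apply_skew (isSkewMap_rotGen _), Finset.sum_add_distrib,
    ← Finset.mul_sum, ← sum_inner, sum_rotGen_rotGen, h6, inner_smul_left]
  have h7 := beltrami_greenKernel_eq (ε := 0) (t := ⟪(ξ : E3), (η : E3)⟫) (by linarith)
  simp only [peakKernel] at h7
  simp
  norm_num at h7
  linarith

lemma sum_integral_rotKernelDeriv {g : UnitSphere → ℝ} {ξ : UnitSphere} (hgξ : g ξ = 0)
    (hint : ∀ i, Integrable (fun η => g η • rotKernelDeriv (rotGen i) ξ η) surfaceMeasure) :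
    ∑ i, (∫ η, g η • rotKernelDeriv (rotGen i) ξ η ∂surfaceMeasure) (rotGen i ξ) =
      -(1 / (4 * Real.pi) * ∫ η, g η ∂surfaceMeasure) := by
  simp only [ContinuousLinearMap.integral_apply (hint _)]
  rw [← integral_finsetSum _ fun i _ => (hint i).apply_continuousLinearMap _, ← integral_const_mul,
    ← integral_neg]
  refine integral_congr_ae (Eventually.of_forall fun η => ?_)
  simp only [smul_apply, smul_eq_mul, ← Finset.mul_sum]
  -- At the pole the kernel identity fails, but there `g` vanishes.
  by_cases h : ξ = η
  · simp [← h, hgξ]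
  · rw [sum_rotKernelDeriv h]; ring

end FarPart

/-! ### The Laplacian through rotational derivatives -/

section Laplacian

/-- A function whose derivative is a combination of infinitesimal rotations with `C¹` coefficients
is of class `C²`, and its Laplacian on the unit sphere is the sum of the rotational derivatives of
these coefficients. -/
lemma contDiffAt_and_laplacian_of_rotational {V : E3 → ℝ} {W : Fin 3 → E3 → ℝ} {ξ : UnitSphere}
    {D : E3 → E3 →L[ℝ] ℝ} (hV : ∀ᶠ x in 𝓝 (ξ : E3), HasFDerivAt V (D x) x)
    (hD : ∀ᶠ x in 𝓝 (ξ : E3), ∀ v, D x v = (‖x‖ ^ 2)⁻¹ * ∑ i, ⟪rotGen i x, v⟫ * W i x)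
    (hW : ∀ i, ContDiffAt ℝ 1 (W i) ξ) :
    ContDiffAt ℝ 2 V ξ ∧
      Laplacian.laplacian V (ξ : E3) = ∑ i, fderiv ℝ (W i) ξ (rotGen i ξ) := by
  have hξ0 : (ξ : E3) ≠ 0 := ne_zero_of_mem_unit_sphere ξ
  let D' : E3 → E3 →L[ℝ] ℝ := fun x => (‖x‖ ^ 2)⁻¹ • ∑ i, W i x • innerSL ℝ (rotGen i x)
  have hDD : ∀ x v, D' x v = (‖x‖ ^ 2)⁻¹ * ∑ i, ⟪rotGen i x, v⟫ * W i x := fun x v => by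
    simp [D', mul_comm]
  have hDD' : D =ᶠ[𝓝 (ξ : E3)] D' := by
    filter_upwards [hD] with x hx
    ext1 v
    rw [hx, hDD]
  have hcD : ContDiffAt ℝ 1 D' ξ := by
    have h1 : ∀ i, ContDiffAt ℝ 1 (fun x : E3 => innerSL ℝ (rotGen i x)) ξ := fun i =>
      ((innerSL ℝ).contDiff.comp (rotGen i).contDiff).contDiffAt
    have h2 : ContDiffAt ℝ 1 (fun x : E3 => (‖x‖ ^ 2)⁻¹) ξ :=
      (contDiffAt_id.norm_sq ℝ).inv (by simp)
    exact h2.smul (ContDiffAt.sum fun i _ => (hW i).smul (h1 i))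
  have hfV : fderiv ℝ V =ᶠ[𝓝 (ξ : E3)] D' := by
    filter_upwards [hV, hDD'] with x h1 h2
    rw [h1.fderiv, h2]
  constructor
  · rw [show (2 : ℕ∞ω) = (1 : ℕ) + 1 by norm_num]
    rw [contDiffAt_succ_iff_hasFDerivAt]
    refine ⟨D', ?_, by exact_mod_cast hcD⟩
    obtain ⟨u, hu, hu'⟩ := (hV.and hDD').exists_mem
    exact ⟨u, hu, fun x hx => by have := hu' x hx; rw [← this.2]; exact this.1⟩
  · rw [congrFun (InnerProductSpace.laplacian_eq_iteratedFDeriv_orthonormalBasis V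
      (EuclideanSpace.basisFun (Fin 3) ℝ)) ξ]
    simp only [iteratedFDeriv_two_apply, hfV.fderiv_eq]
    -- The first term comes from `‖x‖ ^ (-2)`. Differentiating `⟪rotGen i x, v⟫` in direction `v`
    -- contributes `⟪rotGen i v, v⟫ = 0`.
    have hkey : ∀ v, fderiv ℝ D' ξ v v = -2 * ⟪(ξ : E3), v⟫ * ∑ i, ⟪rotGen i ξ, v⟫ * W i ξ +
        ∑ i, ⟪rotGen i ξ, v⟫ * fderiv ℝ (W i) ξ v := by
      intro v
      have h1 : HasFDerivAt (fun x => D' x v) ((fderiv ℝ D' ξ).flip v) (ξ : E3) := by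
        have := (hcD.differentiableAt (by norm_num)).hasFDerivAt.clm_apply
          (hasFDerivAt_const v (ξ : E3))
        refine this.congr_fderiv ?_
        ext w; simp
      have h2 : HasFDerivAt (fun x : E3 => (‖x‖ ^ 2)⁻¹) (-(2 : ℝ) • innerSL ℝ (ξ : E3)) (ξ : E3) := by
        have h3 := (hasDerivAt_inv (x := ‖(ξ : E3)‖ ^ 2) (by simp)).comp_hasFDerivAt (ξ : E3)
          (hasStrictFDerivAt_norm_sq (ξ : E3)).hasFDerivAt
        refine h3.congr_fderiv ?_
        ext w; simp
      have h4 : ∀ i, HasFDerivAt (fun x => ⟪rotGen i x, v⟫ * W i x)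
          (⟪rotGen i ξ, v⟫ • fderiv ℝ (W i) ξ +
            W i ξ • (innerSL ℝ v).comp (rotGen i)) (ξ : E3) := fun i => by
        have h5 : HasFDerivAt (fun x => ⟪rotGen i x, v⟫) ((innerSL ℝ v).comp (rotGen i))
            (ξ : E3) := by
          have h6 := ((innerSL ℝ v).comp (rotGen i)).hasFDerivAt (x := (ξ : E3))
          have h7 : ⇑((innerSL ℝ v).comp (rotGen i)) = fun x => ⟪rotGen i x, v⟫ := by
            ext y; simp [real_inner_comm]
          rwa [h7] at h6
        exact h5.mul ((hW i).differentiableAt (by norm_num)).hasFDerivAt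
      have h8 := h2.mul (HasFDerivAt.fun_sum (u := Finset.univ) fun i _ => h4 i)
      have h9 : (fun x => D' x v) = fun x => (‖x‖ ^ 2)⁻¹ * ∑ i, ⟪rotGen i x, v⟫ * W i x := by
        ext x; exact hDD x v
      rw [h9] at h1
      have h10 := DFunLike.congr_fun (h1.unique h8) v
      simp only [ContinuousLinearMap.flip_apply] at h10
      rw [h10]
      simp [(isSkewMap_rotGen _).inner_self]
      ring
    simp only [Matrix.cons_val_zero, Matrix.cons_val_one, hkey, Finset.sum_add_distrib,
      Finset.mul_sum]
    rw [Finset.sum_comm]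
    rw [Finset.sum_comm (s := Finset.univ) (t := Finset.univ)
      (f := fun j i => ⟪rotGen i ξ, EuclideanSpace.basisFun (Fin 3) ℝ j⟫ *
        fderiv ℝ (W i) ξ (EuclideanSpace.basisFun (Fin 3) ℝ j))]
    -- By Parseval this is a multiple of `⟪ξ, rotGen i ξ⟫`, which vanishes by skewness.
    have h11 : ∀ i : Fin 3, ∑ j, -2 * ⟪(ξ : E3), EuclideanSpace.basisFun (Fin 3) ℝ j⟫ *
        (⟪rotGen i ξ, EuclideanSpace.basisFun (Fin 3) ℝ j⟫ * W i ξ) = 0 := fun i => by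
      have h12 := (EuclideanSpace.basisFun (Fin 3) ℝ).sum_inner_mul_inner (ξ : E3) (rotGen i ξ)
      rw [(isSkewMap_rotGen i).inner_self] at h12
      rw [← mul_zero (-2 * W i ξ), ← h12, Finset.mul_sum]
      refine Finset.sum_congr rfl fun j _ => ?_
      rw [real_inner_comm (rotGen i (ξ : E3))]
      ring
    simp only [h11, Finset.sum_const_zero, zero_add]
    refine Finset.sum_congr rfl fun i _ => ?_
    conv_rhs => rw [← (EuclideanSpace.basisFun (Fin 3) ℝ).sum_repr' (rotGen i ξ), map_sum]
    refine Finset.sum_congr rfl fun j _ => ?_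
    rw [map_smul, smul_eq_mul, real_inner_comm]

end Laplacian

/-! ### Smoothness on the sphere versus smoothness of the radial extension -/

section RadialExtension

lemma radialExtension_of_coe_eq_nrm (F : UnitSphere → ℝ) {x : E3} (hx : x ≠ 0) {ξ : UnitSphere}
    (hξ : (ξ : E3) = nrm x) : radialExtension F x = F ξ := by
  rw [radialExtension, dif_pos hx]
  congr 1
  exact Subtype.ext hξ.symm

lemma radialExtension_coe (F : UnitSphere → ℝ) (ξ : UnitSphere) : radialExtension F ξ = F ξ :=
  radialExtension_of_coe_eq_nrm F (ne_zero_of_mem_unit_sphere ξ) (nrm_coe ξ).symm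

/-- On the open submanifold of nonzero vectors, the extension is `F` composed with the smooth
projection onto the sphere. -/
lemma contDiffAt_radialExtension {k : ℕ} {F : UnitSphere → ℝ} {ξ : UnitSphere}
    (h : ContMDiffAt (𝓡 2) 𝓘(ℝ, ℝ) k F ξ) : ContDiffAt ℝ k (radialExtension F) ξ := by
  let O : TopologicalSpace.Opens E3 := ⟨{0}ᶜ, isOpen_compl_singleton⟩
  have hO : ∀ x : O, (x : E3) ≠ 0 := fun x => x.2
  have hsph : ∀ x : O, nrm (x : E3) ∈ sphere (0 : E3) 1 := fun x => by
    simp [norm_nrm (hO x)]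
  have h1 : ContMDiff 𝓘(ℝ, E3) 𝓘(ℝ, E3) k (fun x : O => nrm (x : E3)) := fun x =>
    contMDiffAt_subtype_iff.2 (contDiffAt_nrm (hO x)).contMDiffAt
  have h2 := h1.codRestrict_sphere (n := 2) hsph
  let x₀ : O := ⟨ξ, ne_zero_of_mem_unit_sphere ξ⟩
  have hx₀ : Set.codRestrict (fun x : O => nrm (x : E3)) _ hsph x₀ = ξ :=
    Subtype.ext (nrm_coe ξ)
  rw [← hx₀] at h
  have h3 := h.comp x₀ (h2 x₀)
  have h4 : F ∘ Set.codRestrict (fun x : O => nrm (x : E3)) _ hsph =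
      fun x : O => radialExtension F (x : E3) := by
    ext x
    exact (radialExtension_of_coe_eq_nrm F (hO x) rfl).symm
  rw [h4] at h3
  exact (contMDiffAt_subtype_iff.1 h3).contDiffAt

lemma contMDiffAt_of_radialExtension {k : ℕ} {F : UnitSphere → ℝ} {ξ : UnitSphere}
    (h : ContDiffAt ℝ k (radialExtension F) ξ) : ContMDiffAt (𝓡 2) 𝓘(ℝ, ℝ) k F ξ := by
  have h1 := h.contMDiffAt.comp ξ (contMDiff_coe_sphere (n := 2) ξ)
  have h2 : radialExtension F ∘ ((↑) : UnitSphere → E3) = F := by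
    ext η; exact radialExtension_coe F η
  rwa [h2] at h1

end RadialExtension

/-! ### Localization and the Poisson equation -/

section Main

lemma surfacePotential_eq_potential {Γ : Set UnitSphere} (hΓ : IsOpen Γ) (H : UnitSphere → ℝ)
    {x : E3} (hx : x ≠ 0) :
    radialExtension (surfacePotential Γ H) x = potential 0 (Γ.indicator H) x := by
  obtain ⟨ξ, hξ⟩ := exists_coe_eq_nrm hx
  rw [radialExtension_of_coe_eq_nrm _ hx hξ, surfacePotential, potential,
    ← integral_indicator hΓ.measurableSet, greenKernel_zero, hξ]
  refine integral_congr_ae (Eventually.of_forall fun η => ?_)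
  by_cases h : η ∈ Γ <;> simp [h]

lemma rotPotential_add {g₁ g₂ : UnitSphere → ℝ} (h₁ : Measurable g₁) {M₁ : ℝ}
    (hM₁ : ∀ η, |g₁ η| ≤ M₁) (h₂ : Measurable g₂) {M₂ : ℝ} (hM₂ : ∀ η, |g₂ η| ≤ M₂)
    {A : E3 →L[ℝ] E3} (hA : IsSkewMap A) {x : E3} (hx : x ≠ 0) :
    rotPotential 0 A (fun η => g₁ η + g₂ η) x = rotPotential 0 A g₁ x + rotPotential 0 A g₂ x := by
  rw [rotPotential, rotPotential, rotPotential, ← integral_add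
    (integrable_rotPotential le_rfl hA h₁ hM₁ hx) (integrable_rotPotential le_rfl hA h₂ hM₂ hx)]
  simp only [mul_add]

/-- A density that is `C¹` near a point of the sphere is the sum of a density that is `C¹` on the
sphere and of one that vanishes near the point. -/
lemma exists_contDiff_localization {Γ : Set UnitSphere} (hΓ : IsOpen Γ) {H : UnitSphere → ℝ}
    (hH : IsClassC 1 Γ H) {ξ : UnitSphere} (hξ : ξ ∈ Γ) :
    ∃ f : E3 → ℝ, (∀ η : UnitSphere, ContDiffAt ℝ 1 f η) ∧ f ξ = H ξ ∧ ∃ ρ > 0,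
      ∀ η : UnitSphere, Γ.indicator H η - f η ≠ 0 → ρ ≤ dist (η : E3) ξ := by
  obtain ⟨R, hR, hball⟩ := Metric.isOpen_iff.1 hΓ ξ hξ
  -- The outer radius `R / 2` is less than `R`, so the product vanishes near every point of the
  -- sphere where `H` might not be `C¹`. The inner radius `R / 4` becomes `ρ`.
  let χ : ContDiffBump (ξ : E3) := ⟨R / 4, R / 2, by positivity, by linarith⟩
  have hmem : ∀ η : UnitSphere, dist (η : E3) ξ < R → η ∈ Γ := fun η h => hball h
  refine ⟨fun y => χ y * radialExtension H y, fun η => ?_, ?_, R / 4, by positivity, fun η h => ?_⟩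
  · by_cases hη : dist (η : E3) ξ < R
    · exact χ.contDiff.contDiffAt.mul (contDiffAt_radialExtension
        ((hH η (hmem η hη)).contMDiffAt (hΓ.mem_nhds (hmem η hη))))
    · have h0 : (fun y => χ y * radialExtension H y) =ᶠ[𝓝 (η : E3)] fun _ => 0 := by
        have : ∀ᶠ y in 𝓝 (η : E3), R / 2 < dist y (ξ : E3) :=
          (continuous_id.dist continuous_const).continuousAt.eventually_const_lt (by
            simp only [id]; linarith)
        filter_upwards [this] with y hy
        rw [χ.zero_of_le_dist hy.le, zero_mul]
      exact contDiffAt_const.congr_of_eventuallyEq h0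
  · beta_reduce
    rw [χ.one_of_mem_closedBall (mem_closedBall_self χ.rIn_pos.le), one_mul, radialExtension_coe]
  · by_contra hlt
    push Not at hlt
    have h1 : χ (η : E3) = 1 := χ.one_of_mem_closedBall hlt.le
    have h2 : η ∈ Γ := hmem η (by linarith)
    simp [h1, h2, radialExtension_coe] at h

/-- Regularity and the Poisson equation for the surface potential at one point. -/
lemma surfacePotential_poisson {Γ : Set UnitSphere} (hΓ : IsOpen Γ) {H : UnitSphere → ℝ}
    (hH : IsClassC 1 Γ H) (hm : Measurable (Γ.indicator H)) {M : ℝ}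
    (hM : ∀ η, |Γ.indicator H η| ≤ M) {ξ : UnitSphere} (hξ : ξ ∈ Γ) :
    ContDiffAt ℝ 2 (radialExtension (surfacePotential Γ H)) ξ ∧
      Laplacian.laplacian (radialExtension (surfacePotential Γ H)) (ξ : E3) =
        H ξ - 1 / (4 * Real.pi) * ∫ η in Γ, H η ∂surfaceMeasure := by
  have hξ0 : (ξ : E3) ≠ 0 := ne_zero_of_mem_unit_sphere ξ
  obtain ⟨f, hf, hfξ, ρ, hρ, hsupp⟩ := exists_contDiff_localization hΓ hH hξ
  have hfc := continuous_comp_coe hf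
  obtain ⟨Mf, hMf⟩ := exists_abs_le_of_continuous hfc
  set g : UnitSphere → ℝ := fun η => Γ.indicator H η - f η with hg
  have hgm : Measurable g := hm.sub hfc.measurable
  have hgM : ∀ η, |g η| ≤ M + Mf := fun η =>
    (abs_sub _ _).trans (add_le_add (hM η) (hMf η))
  have hgξ : g ξ = 0 := by simp [hg, hξ, hfξ]
  choose B hBo hBξ hBd hBc hBi using fun i => hasFDerivAt_rotPotential_of_far
    (A := rotGen i) hgm hgM ξ hρ hsupp
  have hW : ∀ i, ∀ x : E3, x ≠ 0 → rotPotential 0 (rotGen i) (Γ.indicator H) x =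
      potential 0 (fun η => fderiv ℝ f η (rotGen i η)) x + rotPotential 0 (rotGen i) g x := by
    intro i x hx
    rw [← rotPotential_eq_potential (isSkewMap_rotGen i) hf hx,
      ← rotPotential_add hfc.measurable hMf hgm hgM (isSkewMap_rotGen i) hx]
    simp [hg]
  have hWd : ∀ i, ∀ᶠ x in 𝓝 (ξ : E3), HasFDerivAt (rotPotential 0 (rotGen i) (Γ.indicator H))
      (potentialDeriv 0 (fun η => fderiv ℝ f η (rotGen i η)) x +
        ∫ η, g η • rotKernelDeriv (rotGen i) x η ∂surfaceMeasure) x := by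
    intro i
    have hc := continuous_fderiv_skew hf (rotGen i)
    obtain ⟨K, hK⟩ := exists_abs_le_of_continuous hc
    filter_upwards [(hBo i).mem_nhds (hBξ i), isOpen_ne.mem_nhds hξ0] with x hx hx0
    refine ((hasFDerivAt_potential hc.measurable hK hx0).1.add (hBd i x hx)).congr_of_eventuallyEq ?_
    filter_upwards [isOpen_ne.mem_nhds hx0] with y hy
    exact hW i y hy
  have hWc : ∀ i, ContDiffAt ℝ 1 (rotPotential 0 (rotGen i) (Γ.indicator H)) ξ := by
    intro i
    have hc := continuous_fderiv_skew hf (rotGen i)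
    obtain ⟨K, hK⟩ := exists_abs_le_of_continuous hc
    obtain ⟨u, hu, hu'⟩ := (hWd i).exists_mem
    rw [contDiffAt_one_iff]
    refine ⟨_, u ∩ ({0}ᶜ ∩ B i), Filter.inter_mem hu (Filter.inter_mem
      (isOpen_compl_singleton.mem_nhds hξ0) ((hBo i).mem_nhds (hBξ i))), ?_, fun x hx => hu' x hx.1⟩
    intro x hx
    exact (((hasFDerivAt_potential hc.measurable hK hx.2.1).2).add
      ((hBc i).continuousAt ((hBo i).mem_nhds hx.2.2))).continuousWithinAt
  have hVeq : radialExtension (surfacePotential Γ H) =ᶠ[𝓝 (ξ : E3)]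
      potential 0 (Γ.indicator H) := by
    filter_upwards [isOpen_ne.mem_nhds hξ0] with x hx
    exact surfacePotential_eq_potential hΓ H hx
  obtain ⟨h1, h2⟩ := contDiffAt_and_laplacian_of_rotational (V := potential 0 (Γ.indicator H))
    (W := fun i => rotPotential 0 (rotGen i) (Γ.indicator H)) (ξ := ξ)
    (D := potentialDeriv 0 (Γ.indicator H))
    (by filter_upwards [isOpen_ne.mem_nhds hξ0] with x hx using (hasFDerivAt_potential hm hM hx).1)
    (by
      filter_upwards [isOpen_ne.mem_nhds hξ0] with x hx v
      exact potentialDeriv_apply le_rfl hm hM hx v)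
    hWc
  refine ⟨h1.congr_of_eventuallyEq hVeq, ?_⟩
  rw [(InnerProductSpace.laplacian_congr_nhds hVeq).eq_of_nhds, h2]
  simp only [fun i => (hWd i).self_of_nhds.fderiv, add_apply, Finset.sum_add_distrib]
  rw [sum_integral_rotKernelDeriv hgξ hBi]
  have h3 : ∀ i, potentialDeriv 0 (fun η : UnitSphere => fderiv ℝ f η (rotGen i η)) ξ
      (rotGen i ξ) = rotPotential 0 (rotGen i) (fun η => fderiv ℝ f η (rotGen i η)) ξ := by
    intro i
    have hc := continuous_fderiv_skew hf (rotGen i)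
    obtain ⟨K, hK⟩ := exists_abs_le_of_continuous hc
    exact potentialDeriv_apply_skew le_rfl (isSkewMap_rotGen i) hc.measurable hK hξ0
  simp only [h3]
  -- The near part contributes `f ξ` minus the mean of `f`, the far part minus the mean of `g`; the
  -- two means add up to that of the density on `Γ`.
  rw [sum_rotPotential_fderiv hf ξ, hfξ, ← integral_indicator hΓ.measurableSet, hg,
    integral_sub (integrable_of_bounded hm hM) (integrable_of_continuous_unitSphere hfc)]
  ring

end Main

theorem mainTheorem12 (Γ : Set UnitSphere) (hΓ : IsOpen Γ) (H : UnitSphere → ℝ)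
    (hH : IsClassC1Closure Γ H) :
    (∀ ξ : UnitSphere, IntegrableOn
      (fun η : UnitSphere => fundamentalSolution ⟪(ξ : E3), (η : E3)⟫ * H η) Γ surfaceMeasure) ∧
    IntegrableOn H Γ surfaceMeasure ∧
    IsClassC 2 Γ (surfacePotential Γ H) ∧
    ∀ ξ ∈ Γ, beltrami (surfacePotential Γ H) ξ =
      H ξ - 1 / (4 * Real.pi) * ∫ η in Γ, H η ∂surfaceMeasure := by
  obtain ⟨M, hM⟩ := isClosed_closure.isCompact.exists_bound_of_continuousOn hH.continuousOn
  -- The bound must also hold off `Γ`, and for empty `Γ` compactness gives no sign for `M`.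
  have hM' : ∀ η, |Γ.indicator H η| ≤ max M 0 := fun η => by
    by_cases h : η ∈ Γ
    · simpa [h] using Or.inl (hM η (subset_closure h))
    · simp [h]
  have hm : Measurable (Γ.indicator H) := by
    classical
    exact (hH.continuousOn.mono subset_closure).measurable_piecewise continuousOn_const
      hΓ.measurableSet
  refine ⟨fun ξ => ?_, ?_, fun ξ hξ => ?_, fun ξ hξ => ?_⟩
  · have h := integrable_greenKernel_mul le_rfl zero_le_one hm hM' ξ
    rw [← integrable_indicator_iff hΓ.measurableSet]
    refine h.congr (Eventually.of_forall fun η => ?_)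
    by_cases h : η ∈ Γ <;> simp [h, greenKernel_zero]
  · rw [← integrable_indicator_iff hΓ.measurableSet]
    exact integrable_of_bounded hm hM'
  · exact (contMDiffAt_of_radialExtension
      (surfacePotential_poisson hΓ hH.isClassC hm hM' hξ).1).contMDiffWithinAt
  · exact (surfacePotential_poisson hΓ hH.isClassC hm hM' hξ).2
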